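/- Let $\mathbb{T}=[0,1]/\{0\sim1\}$ and let $\mathrm{Diff}^k(\mathbb{T})$ be the set of orientation-preserving $C^k$-diffeomorphisms of $\mathbb{T}$ ($\phi'>0$), where $\mathrm{Diff}^1(\mathbb{T})$ carries the $C^1$-topology and its Borel $\sigma$-algebra. Let $\mathrm{Diff}^3[0,1]$ be the set of $C^3$-diffeomorphisms $f$ of $[0,1]$ with $f'>0$, $f(0)=0$, $f(1)=1$ ($C^3$ up to the endpoints, with one-sided derivatives there). For a measure $\mu$ on $\mathrm{Diff}^1(\mathbb{T})$ and $f\in\mathrm{Diff}^1(\mathbb{T})$ put $f^*\mu(A)=\mu(\{f\circ\phi:\phi\in A\})$, and let $\mathcal{S}_f=\left(\frac{f''}{f'}\right)'-\frac12\left(\frac{f''}{f'}\right)^2$ be the Schwarzian derivative. Let $\sigma>0$ and $\alpha\in\mathbb{R}_{\ge0}\cup i\mathbb{R}_{\ge0}$, so that $\alpha^2\in\mathbb{R}$ is arbitrary. A Radon measure $\mu$ on $\mathrm{Diff}^1(\mathbb{T})$ is called an (unquotiented Virasoro) $\alpha$-orbital measure if, for every $\psi\in\mathrm{Diff}^3(\mathbb{T})$,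 $\psi^*\mu$ is absolutely continuous with respect to $\mu$ with $$\frac{\mathrm{d}\psi^*\mu}{\mathrm{d}\mu}(\phi)=\exp\left\{\frac1{\sigma^2}\int_{\mathbb{T}}\left[\mathcal{S}_\psi(\phi(\tau))+2\alpha^2\big(\psi'(\phi(\tau))^2-1\big)\right]\phi'(\tau)^2\,\mathrm{d}\tau\right\}.$$ For such $\mu$ and $t_0\in\mathbb{T}$, the $\alpha$-orbital measure pinned at $t_0$ is the image $\mu^{t_0}$ of $\mu$ under $\phi\mapsto\phi-\phi(t_0)$. Let $\mu$ be an $\alpha$-orbital measure, let $t_0\in\mathbb{T}$ and let $f\in\mathrm{Diff}^1(\mathbb{T})\cap\mathrm{Diff}^3[0,1]$; that is, $f\in\mathrm{Diff}^3[0,1]$ and $f'(0)=f'(1)$. Then $f^*\mu^{t_0}$ and $\mu^{t_0}$ are mutually absolutely continuous, and for $\mu^{t_0}$-almost every $\phi$ $$\frac{\mathrm{d}f^*\mu^{t_0}}{\mathrm{d}\mu^{t_0}}(\phi)=\frac1{\sqrt{f'(0)f'(1)}}\exp\left\{\frac1{\sigma^2}\left[\frac{f''(0)}{f'(0)}-\frac{f''(1)}{f'(1)}\right]\phi'(t_0)+\frac1{\sigma^2}\int_{\mathbb{T}\setminus\{t_0\}}\left[\mathcal{S}_f(\phi(\tau))+2\alpha^2\big(f'(\phi(\tau))^2-1\big)\right]\phi'(\tau)^2\,\mathrm{d}\tau\right\}.$$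 -/

import Mathlib

open MeasureTheory Set
open scoped ENNReal

noncomputable section

/-- The circle `𝕋 = [0,1]/{0 ∼ 1}`. -/
abbrev Circ : Type := AddCircle (1 : ℝ)

/-- The representative in `[0,1)` of a point of the circle. -/
def circRep (x : Circ) : ℝ := (AddCircle.equivIco (1 : ℝ) 0 x : ℝ)

/-- The function `F : ℝ → ℝ` is the lift of an orientation-preserving `C^k`-diffeomorphism
of the circle (`k ≥ 1`): it is `C^k`, it has positive derivative and `F (x + 1) = F x + 1`. -/
structure IsCircleLift (k : ℕ) (F : ℝ → ℝ) : Prop where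
  contDiff : ContDiff ℝ k F
  deriv_pos : ∀ x, 0 < deriv F x
  add_one : ∀ x, F (x + 1) = F x + 1

/-- `Diff^k(𝕋)` for `k ≥ 1`: maps `𝕋 → 𝕋` that are induced by a lift as above. -/
structure CircleDiff (k : ℕ) where
  toFun : Circ → Circ
  exists_lift : ∃ F : ℝ → ℝ, IsCircleLift k F ∧ ∀ x : ℝ, toFun (x : Circ) = (F x : Circ)

namespace CircleDiff

variable {k : ℕ}

instance : CoeFun (CircleDiff k) (fun _ => Circ → Circ) := ⟨CircleDiff.toFun⟩

/-- A lift of `φ` to `ℝ`. It is unique up to an additive integer constant, so its derivatives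
do not depend on the choice. -/
def lift (φ : CircleDiff k) : ℝ → ℝ := φ.exists_lift.choose

theorem isCircleLift_lift (φ : CircleDiff k) : IsCircleLift k φ.lift :=
  φ.exists_lift.choose_spec.1

theorem coe_lift (φ : CircleDiff k) (x : ℝ) : φ (x : Circ) = (φ.lift x : Circ) :=
  φ.exists_lift.choose_spec.2 x

theorem periodic_deriv_lift (φ : CircleDiff k) : Function.Periodic (deriv φ.lift) 1 := by
  intro x
  have h : (fun y => φ.lift (y + 1)) = fun y => φ.lift y + 1 :=
    funext φ.isCircleLift_lift.add_one
  have h1 := congrArg (fun G => deriv G x) h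
  simpa [deriv_comp_add_const] using h1

/-- The derivative `φ' : 𝕋 → ℝ`. -/
def deriv (φ : CircleDiff k) : Circ → ℝ := φ.periodic_deriv_lift.lift

/-- A `C^k`-diffeomorphism regarded as a `C^m`-diffeomorphism, `m ≤ k`. -/
def ofLE {m : ℕ} (h : m ≤ k) (φ : CircleDiff k) : CircleDiff m where
  toFun := φ
  exists_lift := ⟨φ.lift,
    ⟨φ.isCircleLift_lift.contDiff.of_le (by exact_mod_cast h), φ.isCircleLift_lift.deriv_pos,
      φ.isCircleLift_lift.add_one⟩, φ.coe_lift⟩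

/-- The composition `ψ ∘ φ`. -/
def comp (ψ φ : CircleDiff k) : CircleDiff k where
  toFun := fun x => ψ (φ x)
  exists_lift := by
    have hψ := ψ.isCircleLift_lift
    have hφ := φ.isCircleLift_lift
    refine ⟨fun x => ψ.lift (φ.lift x), ⟨hψ.contDiff.comp hφ.contDiff, fun x => ?_, fun x => ?_⟩,
      fun x => ?_⟩
    · have h1 := (differentiableAt_of_deriv_ne_zero (hψ.deriv_pos (φ.lift x)).ne').hasDerivAt
      have h2 := (differentiableAt_of_deriv_ne_zero (hφ.deriv_pos x).ne').hasDerivAt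
      have h3 := (h1.comp x h2).deriv
      have h4 : _root_.deriv (fun x => ψ.lift (φ.lift x)) x
          = _root_.deriv ψ.lift (φ.lift x) * _root_.deriv φ.lift x := h3
      rw [h4]
      exact mul_pos (hψ.deriv_pos _) (hφ.deriv_pos _)
    · simp only [hφ.add_one, hψ.add_one]
    · rw [φ.coe_lift, ψ.coe_lift]

/-- The rotated diffeomorphism `φ + θ`. -/
def addConst (φ : CircleDiff k) (θ : Circ) : CircleDiff k where
  toFun := fun x => φ x + θ
  exists_lift := by
    obtain ⟨c, rfl⟩ := QuotientAddGroup.mk_surjective θ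
    have hφ := φ.isCircleLift_lift
    refine ⟨fun x => φ.lift x + c, ⟨hφ.contDiff.add contDiff_const, fun x => ?_, fun x => ?_⟩,
      fun x => ?_⟩
    · simpa using hφ.deriv_pos x
    · rw [hφ.add_one]; ring
    · rw [φ.coe_lift]; rfl

theorem continuous_coe (φ : CircleDiff k) : Continuous φ := by
  rw [(QuotientAddGroup.isQuotientMap_mk (AddSubgroup.zmultiples (1 : ℝ))).continuous_iff]
  have h : (φ.toFun ∘ fun x : ℝ => (x : Circ)) = fun x => (φ.lift x : Circ) :=
    funext φ.coe_lift
  exact h ▸ (AddCircle.continuous_mk' 1).comp φ.isCircleLift_lift.contDiff.continuous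

theorem continuous_deriv (φ : CircleDiff 1) : Continuous φ.deriv := by
  rw [(QuotientAddGroup.isQuotientMap_mk (AddSubgroup.zmultiples (1 : ℝ))).continuous_iff]
  exact φ.isCircleLift_lift.contDiff.continuous_deriv (by simp)

/-- The pair `(φ, φ')` in `C(𝕋, 𝕋) × C(𝕋, ℝ)`. -/
def toC1 (φ : CircleDiff 1) : C(Circ, Circ) × C(Circ, ℝ) :=
  (⟨φ, φ.continuous_coe⟩, ⟨φ.deriv, φ.continuous_deriv⟩)

/-- The `C¹` topology on `Diff¹(𝕋)`: uniform convergence of `φ` and of `φ'`. -/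
instance : TopologicalSpace (CircleDiff 1) := TopologicalSpace.induced toC1 inferInstance

instance : MeasurableSpace (CircleDiff 1) := borel _

instance : BorelSpace (CircleDiff 1) := ⟨rfl⟩

end CircleDiff

/-- The Schwarzian derivative `(f''/f')' - (1/2) (f''/f')²`, with derivatives taken within `s`
(one-sided at the endpoints of an interval). -/
def schwarzianWithin (s : Set ℝ) (f : ℝ → ℝ) (x : ℝ) : ℝ :=
  derivWithin (fun y => iteratedDerivWithin 2 f s y / derivWithin f s y) s x
    - 1 / 2 * (iteratedDerivWithin 2 f s x / derivWithin f s x) ^ 2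

/-- The Schwarzian derivative `𝒮_ψ : 𝕋 → ℝ` of a diffeomorphism of the circle. -/
def CircleDiff.schwarzian {k : ℕ} (ψ : CircleDiff k) (x : Circ) : ℝ :=
  schwarzianWithin univ ψ.lift (circRep x)

/-- `g` restricted to `[0,1]` belongs to `Diff^k[0,1]` for `k ≥ 1`: it is `C^k` up to the
endpoints, it has positive derivative and it fixes `0` and `1`. Nothing relates the derivatives
at the two endpoints. -/
structure IsIntervalDiff (k : ℕ) (g : ℝ → ℝ) : Prop where
  contDiffOn : ContDiffOn ℝ k g (Icc 0 1)
  deriv_pos : ∀ x ∈ Icc (0 : ℝ) 1, 0 < derivWithin g (Icc 0 1) x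
  map_zero : g 0 = 0
  map_one : g 1 = 1

/-- The pullback `f^* μ` under post-composition by `f`, that is `f^* μ (A) = μ (f ∘ A)` where
`f ∘ A = {f ∘ φ | φ ∈ A}`. (Post-composition by `f` is a homeomorphism of `Diff¹(𝕋)`.) -/
def pullbackMeasure (f : CircleDiff 1) (μ : Measure (CircleDiff 1)) : Measure (CircleDiff 1) :=
  Measure.comap (fun φ => f.comp φ) μ

/-- The density in the change of variables formula of orbital measures for post-composition by
`ψ ∈ Diff³(𝕋)`; the real number `a` stands for `α²`. -/
def orbitalDensity (σ a : ℝ) (ψ : CircleDiff 3) (φ : CircleDiff 1) : ℝ :=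
  Real.exp (1 / σ ^ 2 *
    ∫ τ : Circ, (ψ.schwarzian (φ τ) + 2 * a * (ψ.deriv (φ τ) ^ 2 - 1)) * φ.deriv τ ^ 2)

/-- Unquotiented Virasoro `α`-orbital measures with `α² = a`. A Borel measure on the Polish space
`Diff¹(𝕋)` is Radon if and only if it is locally finite. -/
structure IsOrbitalMeasure (σ a : ℝ) (μ : Measure (CircleDiff 1)) : Prop where
  locallyFinite : IsLocallyFiniteMeasure μ
  pullback_eq : ∀ ψ : CircleDiff 3,
    pullbackMeasure (ψ.ofLE (by norm_num)) μ
      = μ.withDensity fun φ => ENNReal.ofReal (orbitalDensity σ a ψ φ)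

/-- The measure `μ` pinned at `t₀`: its image under `φ ↦ φ - φ(t₀)`. -/
def pinnedMeasure (μ : Measure (CircleDiff 1)) (t₀ : Circ) : Measure (CircleDiff 1) :=
  μ.map fun φ => φ.addConst (-φ t₀)

/-- The density in the change of variables formula of pinned orbital measures for post-composition
by the diffeomorphism with restriction `g` to `[0,1]`; the real number `a` stands for `α²`. The
derivatives of `g` at `0` and `1` are one-sided. -/
def pinnedDensity (σ a : ℝ) (t₀ : Circ) (g : ℝ → ℝ) (φ : CircleDiff 1) : ℝ :=
  1 / Real.sqrt (derivWithin g (Icc 0 1) 0 * derivWithin g (Icc 0 1) 1) *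
    Real.exp (
      1 / σ ^ 2 * (iteratedDerivWithin 2 g (Icc 0 1) 0 / derivWithin g (Icc 0 1) 0
        - iteratedDerivWithin 2 g (Icc 0 1) 1 / derivWithin g (Icc 0 1) 1) * φ.deriv t₀
      + 1 / σ ^ 2 * ∫ τ in ({t₀}ᶜ : Set Circ),
          (schwarzianWithin (Icc 0 1) g (circRep (φ τ))
            + 2 * a * (derivWithin g (Icc 0 1) (circRep (φ τ)) ^ 2 - 1)) * φ.deriv τ ^ 2)

end

/-!
Orbital measures are invariant under rotations, so `μ` is the product of the Haar measure of the
rotations and the pinned measure `ν`. For `ψ ∈ Diff³(𝕋)` the change of variables formula of `μ`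
therefore disintegrates into one for `ν`, valid for almost every rotation angle `θ`:
post-composition with `ψ(· + θ) - ψ(θ)` has the orbital density divided by the Jacobian `ψ'(θ)`.
Approximate `f` in `Diff¹(𝕋)` by `ψ ∈ Diff³(𝕋)` for which `(log ψ')'` runs from `f''(1)/f'(1)` to
`f''(0)/f'(0)` on a small neighborhood of `0`. Their Schwarzian derivatives contain a bump of mass
`f''(0)/f'(0) - f''(1)/f'(1)` at `0`, which produces the boundary term proportional to `φ'(t₀)` as
`ψ → f` and `θ → 0`, while the Jacobian tends to `f'(0) = √(f'(0) f'(1))`.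
-/

open Filter Topology
open scoped NNReal BoundedContinuousFunction

/-! ### Lifts of circle maps -/

theorem coe_circ_eq_iff {x y : ℝ} : (x : Circ) = (y : Circ) ↔ ∃ n : ℤ, x = y + n := by
  rw [← sub_eq_zero, ← AddCircle.coe_sub, AddCircle.coe_eq_zero_iff]
  simp only [zsmul_eq_mul, mul_one, sub_eq_iff_eq_add', eq_comm]

theorem exists_int_eqOn_of_coe_eq {F G : ℝ → ℝ} {s : Set ℝ} (hs : IsPreconnected s)
    (hF : ContinuousOn F s) (hG : ContinuousOn G s) (h : ∀ x ∈ s, (F x : Circ) = (G x : Circ)) :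
    ∃ n : ℤ, ∀ x ∈ s, F x = G x + n := by
  have hdiscrete : IsDiscrete (range ((↑) : ℤ → ℝ)) :=
    Int.isClosedEmbedding_coe_real.isInducing.isDiscrete_range
  have hmaps : MapsTo (fun x => F x - G x) s (range ((↑) : ℤ → ℝ)) := fun x hx => by
    obtain ⟨n, hn⟩ := coe_circ_eq_iff.1 (h x hx)
    exact ⟨n, by simp only [hn, add_sub_cancel_left]⟩
  obtain ⟨_, ⟨n, rfl⟩, hn⟩ := hs.eqOn_const_of_mapsTo hdiscrete (hF.sub hG) hmaps (range_nonempty _)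
  exact ⟨n, fun x hx => sub_eq_iff_eq_add'.1 (hn hx)⟩

theorem circRep_coe (x : ℝ) : circRep (x : Circ) = Int.fract x := by
  simp [circRep, AddCircle.coe_equivIco_mk_apply]

theorem coe_circRep (x : Circ) : ((circRep x : ℝ) : Circ) = x := by
  rw [circRep, AddCircle.coe_equivIco]

theorem exists_coe_circ (t : Circ) : ∃ x : ℝ, (x : Circ) = t := ⟨circRep t, coe_circRep t⟩

theorem continuous_circ_iff {X : Type*} [TopologicalSpace X] {f : Circ → X} :
    Continuous f ↔ Continuous fun x : ℝ => f (x : Circ) :=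
  (QuotientAddGroup.isQuotientMap_mk (AddSubgroup.zmultiples (1 : ℝ))).continuous_iff

theorem periodic_deriv_of_periodic {f : ℝ → ℝ} {c : ℝ} (hf : Function.Periodic f c) :
    Function.Periodic (deriv f) c := fun x => by
  rw [← deriv_comp_add_const, funext hf]

theorem periodic_apply_fract {X : Type*} {f : ℝ → X} (hf : Function.Periodic f 1) (x : ℝ) :
    f (Int.fract x) = f x := by
  simpa using hf.sub_int_mul_eq (x := x) ⌊x⌋

namespace IsCircleLift

variable {k : ℕ} {F : ℝ → ℝ}

theorem continuous (hF : IsCircleLift k F) : Continuous F := hF.contDiff.continuous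

theorem strictMono (hF : IsCircleLift k F) : StrictMono F := strictMono_of_deriv_pos hF.deriv_pos

theorem hasDerivAt (hF : IsCircleLift k F) (x : ℝ) : HasDerivAt F (deriv F x) x :=
  (differentiableAt_of_deriv_ne_zero (hF.deriv_pos x).ne').hasDerivAt

theorem differentiable (hF : IsCircleLift k F) : Differentiable ℝ F :=
  fun x => (hF.hasDerivAt x).differentiableAt

theorem of_le {m : ℕ} (hF : IsCircleLift k F) (h : m ≤ k) : IsCircleLift m F :=
  ⟨hF.contDiff.of_le (by exact_mod_cast h), hF.deriv_pos, hF.add_one⟩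

theorem add_int (hF : IsCircleLift k F) (x : ℝ) (n : ℤ) : F (x + n) = F x + n := by
  have hper : Function.Periodic (fun x => F x - x) 1 := fun x => by simp only [hF.add_one]; ring
  have := hper.int_mul n x
  simp only [mul_one] at this
  linarith

theorem surjective (hF : IsCircleLift k F) : Function.Surjective F := by
  intro y
  obtain ⟨n, hn⟩ := exists_int_gt (y - F 0)
  obtain ⟨m, hm⟩ := exists_int_lt (y - F 0)
  exact mem_range_of_exists_le_of_exists_ge hF.continuous
    ⟨0 + m, by linarith [hF.add_int 0 m]⟩ ⟨0 + n, by linarith [hF.add_int 0 n]⟩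

theorem coe_eq_coe (hF : IsCircleLift k F) {x y : ℝ} (h : (x : Circ) = (y : Circ)) :
    (F x : Circ) = (F y : Circ) := by
  obtain ⟨n, rfl⟩ := coe_circ_eq_iff.1 h
  exact coe_circ_eq_iff.2 ⟨n, hF.add_int y n⟩

theorem periodic_deriv (hF : IsCircleLift k F) : Function.Periodic (deriv F) 1 := fun x => by
  rw [← deriv_comp_add_const, funext hF.add_one, deriv_add_const]

theorem continuous_deriv (hF : IsCircleLift k F) (hk : 1 ≤ k) : Continuous (deriv F) :=
  hF.contDiff.continuous_deriv (by exact_mod_cast hk)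

theorem add_const (hF : IsCircleLift k F) (c : ℝ) : IsCircleLift k fun x => F x + c where
  contDiff := hF.contDiff.add contDiff_const
  deriv_pos x := by simpa using hF.deriv_pos x
  add_one x := by rw [hF.add_one, add_right_comm]

/-- The inverse of a lift, as an order isomorphism of `ℝ`. -/
noncomputable def symm (hF : IsCircleLift k F) : ℝ ≃o ℝ :=
  (hF.strictMono.orderIsoOfSurjective F hF.surjective).symm

theorem apply_symm (hF : IsCircleLift k F) (y : ℝ) : F (hF.symm y) = y :=
  (hF.strictMono.orderIsoOfSurjective F hF.surjective).apply_symm_apply y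

theorem symm_apply (hF : IsCircleLift k F) (x : ℝ) : hF.symm (F x) = x :=
  hF.strictMono.injective (hF.apply_symm _)

theorem hasDerivAt_symm (hF : IsCircleLift k F) (y : ℝ) :
    HasDerivAt hF.symm (deriv F (hF.symm y))⁻¹ y :=
  HasDerivAt.of_local_left_inverse hF.symm.continuous.continuousAt (hF.hasDerivAt _)
    (hF.deriv_pos _).ne' (Eventually.of_forall hF.apply_symm)

theorem isCircleLift_symm (hF : IsCircleLift 1 F) : IsCircleLift 1 hF.symm where
  contDiff := by
    rw [Nat.cast_one, contDiff_one_iff_deriv]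
    refine ⟨fun y => (hF.hasDerivAt_symm y).differentiableAt, ?_⟩
    rw [show deriv hF.symm = fun y => (deriv F (hF.symm y))⁻¹ from
      funext fun y => (hF.hasDerivAt_symm y).deriv]
    exact ((hF.continuous_deriv le_rfl).comp hF.symm.continuous).inv₀
      fun y => (hF.deriv_pos _).ne'
  deriv_pos y := by
    rw [(hF.hasDerivAt_symm y).deriv]
    exact inv_pos.2 (hF.deriv_pos _)
  add_one y := hF.strictMono.injective (by rw [hF.apply_symm, hF.add_one, hF.apply_symm])

theorem image_Ioc (hF : IsCircleLift k F) (x y : ℝ) : F '' Ioc x y = Ioc (F x) (F y) :=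
  (hF.strictMono.orderIsoOfSurjective F hF.surjective).image_Ioc x y

end IsCircleLift

theorem isCircleLift_id (k : ℕ) : IsCircleLift k id :=
  ⟨contDiff_id, fun x => by simp, fun _ => rfl⟩

namespace CircleDiff

variable {k : ℕ}

instance : Coe (CircleDiff 3) (CircleDiff 1) := ⟨ofLE (by norm_num)⟩

theorem ext_toFun {φ ψ : CircleDiff k} (h : ∀ x, φ x = ψ x) : φ = ψ := by
  cases φ; cases ψ; congr; exact funext h

/-- The circle diffeomorphism induced by a lift. -/
noncomputable def ofLift (F : ℝ → ℝ) (hF : IsCircleLift k F) : CircleDiff k where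
  toFun := fun x => (F (circRep x) : Circ)
  exists_lift := ⟨F, hF, fun _ => hF.coe_eq_coe (coe_circRep _)⟩

theorem ofLift_coe (F : ℝ → ℝ) (hF : IsCircleLift k F) (x : ℝ) :
    ofLift F hF (x : Circ) = (F x : Circ) := hF.coe_eq_coe (coe_circRep _)

theorem exists_lift_eq_add_int {φ : CircleDiff k} {F : ℝ → ℝ} (hF : Continuous F)
    (h : ∀ x : ℝ, φ (x : Circ) = (F x : Circ)) : ∃ n : ℤ, φ.lift = fun x => F x + n := by
  obtain ⟨n, hn⟩ := exists_int_eqOn_of_coe_eq isPreconnected_univ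
    φ.isCircleLift_lift.continuous.continuousOn hF.continuousOn
    (fun x _ => by rw [← φ.coe_lift, h])
  exact ⟨n, funext fun x => hn x (mem_univ x)⟩

theorem deriv_coe {φ : CircleDiff k} {F : ℝ → ℝ} (hF : Continuous F)
    (h : ∀ x : ℝ, φ (x : Circ) = (F x : Circ)) (x : ℝ) :
    φ.deriv (x : Circ) = _root_.deriv F x := by
  obtain ⟨n, hn⟩ := exists_lift_eq_add_int hF h
  change _root_.deriv φ.lift x = _
  rw [hn, deriv_add_const]

theorem deriv_coe_lift (φ : CircleDiff k) (x : ℝ) :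
    φ.deriv (x : Circ) = _root_.deriv φ.lift x := rfl

theorem deriv_pos (φ : CircleDiff k) (t : Circ) : 0 < φ.deriv t := by
  obtain ⟨x, rfl⟩ := exists_coe_circ t
  exact φ.isCircleLift_lift.deriv_pos x

theorem deriv_comp (ψ φ : CircleDiff k) (t : Circ) :
    (ψ.comp φ).deriv t = ψ.deriv (φ t) * φ.deriv t := by
  obtain ⟨x, rfl⟩ := exists_coe_circ t
  have hψ := ψ.isCircleLift_lift
  have hφ := φ.isCircleLift_lift
  rw [deriv_coe (F := ψ.lift ∘ φ.lift) (hψ.continuous.comp hφ.continuous)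
    (fun x => by change ψ (φ _) = _; rw [φ.coe_lift, ψ.coe_lift]; rfl), φ.coe_lift,
    deriv_coe_lift, deriv_coe_lift]
  exact ((hψ.hasDerivAt _).comp x (hφ.hasDerivAt x)).deriv

theorem deriv_addConst (φ : CircleDiff k) (θ t : Circ) : (φ.addConst θ).deriv t = φ.deriv t := by
  obtain ⟨x, rfl⟩ := exists_coe_circ t
  obtain ⟨c, rfl⟩ := exists_coe_circ θ
  rw [deriv_coe (F := fun x => φ.lift x + c) (φ.isCircleLift_lift.add_const c).continuous
    (fun x => by change φ _ + _ = _; rw [φ.coe_lift, AddCircle.coe_add]), deriv_coe_lift,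
    deriv_add_const]

theorem lintegral_comp_mul_deriv (ψ : CircleDiff k) (h : Circ → ℝ≥0∞) :
    ∫⁻ θ : Circ, ENNReal.ofReal (ψ.deriv θ) * h (ψ θ) = ∫⁻ θ : Circ, h θ := by
  have hF := ψ.isCircleLift_lift
  rw [← AddCircle.lintegral_preimage 1 0, ← AddCircle.lintegral_preimage 1 (ψ.lift 0),
    ← hF.add_one, ← hF.image_Ioc, lintegral_image_eq_lintegral_abs_deriv_mul measurableSet_Ioc
      (fun x _ => (hF.hasDerivAt x).hasDerivWithinAt) hF.strictMono.injective.injOn]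
  simp only [ψ.coe_lift, deriv_coe_lift, abs_of_pos (hF.deriv_pos _)]

/-! ### The topological group `Diff¹(𝕋)` -/

theorem isInducing_toC1 : IsInducing toC1 := ⟨rfl⟩

theorem isEmbedding_toC1 : IsEmbedding toC1 :=
  ⟨isInducing_toC1, fun _ _ h => ext_toFun fun x => congrArg (fun p => p.1 x) h⟩

instance : SecondCountableTopology (CircleDiff 1) := isEmbedding_toC1.secondCountableTopology

instance : TopologicalSpace.MetrizableSpace (CircleDiff 1) := isEmbedding_toC1.metrizableSpace

theorem continuous_eval : Continuous fun p : CircleDiff 1 × Circ => p.1 p.2 :=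
  ((continuous_fst.comp isInducing_toC1.continuous).comp continuous_fst).eval continuous_snd

theorem continuous_eval_deriv : Continuous fun p : CircleDiff 1 × Circ => p.1.deriv p.2 :=
  ((continuous_snd.comp isInducing_toC1.continuous).comp continuous_fst).eval continuous_snd

theorem continuous_of_continuous_eval {X : Type*} [TopologicalSpace X] {f : X → CircleDiff 1}
    (h : Continuous fun p : X × Circ => f p.1 p.2)
    (h' : Continuous fun p : X × Circ => (f p.1).deriv p.2) : Continuous f :=
  isInducing_toC1.continuous_iff.2 <|
    (ContinuousMap.continuous_of_continuous_uncurry (fun x => (toC1 (f x)).1) h).prodMk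
      (ContinuousMap.continuous_of_continuous_uncurry (fun x => (toC1 (f x)).2) h')

/-- The inverse diffeomorphism. -/
noncomputable def inv (φ : CircleDiff 1) : CircleDiff 1 :=
  ofLift _ φ.isCircleLift_lift.isCircleLift_symm

theorem inv_apply_apply (φ : CircleDiff 1) (t : Circ) : φ.inv (φ t) = t := by
  obtain ⟨x, rfl⟩ := exists_coe_circ t
  rw [φ.coe_lift, inv, ofLift_coe, φ.isCircleLift_lift.symm_apply]

/-- The identity diffeomorphism. -/
def refl : CircleDiff 1 where
  toFun := fun x => x
  exists_lift := ⟨id, isCircleLift_id 1, fun _ => rfl⟩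

noncomputable instance : Group (CircleDiff 1) where
  mul := comp
  one := refl
  inv := inv
  mul_assoc _ _ _ := rfl
  one_mul _ := rfl
  mul_one _ := rfl
  inv_mul_cancel φ := ext_toFun φ.inv_apply_apply

theorem mul_apply (ψ φ : CircleDiff 1) (t : Circ) : (ψ * φ) t = ψ (φ t) := rfl

theorem one_apply (t : Circ) : (1 : CircleDiff 1) t = t := rfl

theorem inv_apply_self (φ : CircleDiff 1) (t : Circ) : φ⁻¹ (φ t) = t := φ.inv_apply_apply t

theorem apply_inv_self (φ : CircleDiff 1) (t : Circ) : φ (φ⁻¹ t) = t := by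
  rw [← mul_apply, mul_inv_cancel, one_apply]

theorem deriv_mul (ψ φ : CircleDiff 1) (t : Circ) :
    (ψ * φ).deriv t = ψ.deriv (φ t) * φ.deriv t := deriv_comp ψ φ t

theorem lintegral_comp_inv (φ : CircleDiff 1) (h : Circ → ℝ≥0∞) :
    ∫⁻ θ : Circ, h (φ⁻¹ θ) = ∫⁻ θ : Circ, ENNReal.ofReal (φ.deriv θ) * h θ := by
  simp only [← φ.lintegral_comp_mul_deriv fun θ => h (φ⁻¹ θ), inv_apply_self]

theorem deriv_one (t : Circ) : (1 : CircleDiff 1).deriv t = 1 := by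
  obtain ⟨x, rfl⟩ := exists_coe_circ t
  rw [deriv_coe continuous_id (fun _ => rfl), deriv_id]

theorem deriv_inv (φ : CircleDiff 1) (t : Circ) : φ⁻¹.deriv t = (φ.deriv (φ⁻¹ t))⁻¹ := by
  refine eq_inv_of_mul_eq_one_right ?_
  rw [← deriv_mul, mul_inv_cancel, deriv_one]

/-- By compactness of the circle, the projection of the closed set
`{(φ, y, x) | φ x = y, x ∈ C}` along `x` is closed. -/
theorem continuous_inv_eval : Continuous fun p : CircleDiff 1 × Circ => p.1⁻¹ p.2 := by
  refine continuous_iff_isClosed.2 fun C hC => ?_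
  have heval : Continuous fun q : (CircleDiff 1 × Circ) × Circ => q.1.1 q.2 :=
    continuous_eval.comp ((continuous_fst.comp continuous_fst).prodMk continuous_snd)
  have hgraph : IsClosed {q : (CircleDiff 1 × Circ) × Circ | q.1.1 q.2 = q.1.2 ∧ q.2 ∈ C} :=
    (isClosed_eq heval (by fun_prop)).inter (hC.preimage continuous_snd)
  convert isClosedMap_fst_of_compactSpace _ hgraph using 1
  ext ⟨φ, y⟩
  constructor
  · intro h
    exact ⟨((φ, y), φ⁻¹ y), ⟨φ.apply_inv_self y, h⟩, rfl⟩
  · rintro ⟨⟨⟨_, _⟩, x⟩, ⟨hx, hxC⟩, ⟨⟩⟩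
    obtain rfl : φ x = y := hx
    rwa [mem_preimage, inv_apply_self]

instance : IsTopologicalGroup (CircleDiff 1) where
  continuous_mul := by
    have hinner : Continuous fun q : (CircleDiff 1 × CircleDiff 1) × Circ => (q.1.1, q.1.2 q.2) :=
      (by fun_prop : Continuous fun q : (CircleDiff 1 × CircleDiff 1) × Circ => q.1.1).prodMk
        (continuous_eval.comp (by fun_prop : Continuous fun q : (CircleDiff 1 × CircleDiff 1) × Circ
          => (q.1.2, q.2)))
    refine continuous_of_continuous_eval (continuous_eval.comp hinner) ?_
    simp only [deriv_mul]
    exact (continuous_eval_deriv.comp hinner).mul (continuous_eval_deriv.comp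
      (by fun_prop : Continuous fun q : (CircleDiff 1 × CircleDiff 1) × Circ => (q.1.2, q.2)))
  continuous_inv := by
    refine continuous_of_continuous_eval continuous_inv_eval ?_
    simp only [deriv_inv]
    exact (continuous_eval_deriv.comp (continuous_fst.prodMk continuous_inv_eval)).inv₀
      fun q => (deriv_pos _ _).ne'

/-- The rotation by `θ`. -/
noncomputable def rot (θ : Circ) : CircleDiff 1 := (1 : CircleDiff 1).addConst θ

theorem rot_apply (θ t : Circ) : rot θ t = t + θ := rfl

theorem rot_zero : rot 0 = 1 := ext_toFun fun t => add_zero t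

theorem rot_mul_rot (θ θ' : Circ) : rot θ * rot θ' = rot (θ' + θ) :=
  ext_toFun fun t => by simp only [mul_apply, rot_apply, add_assoc]

theorem continuous_rot : Continuous rot := by
  refine continuous_of_continuous_eval (continuous_snd.add continuous_fst) ?_
  simp only [rot, deriv_addConst, deriv_one, continuous_const]

end CircleDiff

/-! ### The densities in terms of lifts -/

theorem schwarzianWithin_univ (F : ℝ → ℝ) : schwarzianWithin univ F = fun x =>
    deriv (fun y => deriv (deriv F) y / deriv F y) x
      - 1 / 2 * (deriv (deriv F) x / deriv F x) ^ 2 := by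
  funext x
  simp only [schwarzianWithin, derivWithin_univ, iteratedDerivWithin_univ, iteratedDeriv_succ,
    iteratedDeriv_zero]

theorem schwarzianWithin_univ_add_const (F : ℝ → ℝ) (c : ℝ) :
    schwarzianWithin univ (fun x => F x + c) = schwarzianWithin univ F := by
  have hderiv : deriv (fun x => F x + c) = deriv F := funext fun x => deriv_add_const c
  simp only [schwarzianWithin_univ, hderiv]

namespace IsCircleLift

variable {k : ℕ} {F : ℝ → ℝ}

theorem periodic_schwarzianWithin (hF : IsCircleLift k F) :
    Function.Periodic (schwarzianWithin univ F) 1 := by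
  have hF' := hF.periodic_deriv
  have hF'' := periodic_deriv_of_periodic hF'
  have hquot' : Function.Periodic (deriv fun y => deriv (deriv F) y / deriv F y) 1 :=
    periodic_deriv_of_periodic (hF''.div hF')
  intro x
  simp only [schwarzianWithin_univ, hF' x, hF'' x, hquot' x]

theorem continuous_schwarzianWithin (hF : IsCircleLift 3 F) :
    Continuous (schwarzianWithin univ F) := by
  have hF' : ContDiff ℝ (1 + 1) (deriv F) :=
    (contDiff_succ_iff_deriv.1 (hF.contDiff : ContDiff ℝ (2 + 1) F)).2.2
  have hF'' : ContDiff ℝ 1 (deriv (deriv F)) := (contDiff_succ_iff_deriv.1 hF').2.2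
  have hquot : ContDiff ℝ 1 (fun y => deriv (deriv F) y / deriv F y) :=
    hF''.div (hF'.of_le (by norm_num)) fun x => (hF.deriv_pos x).ne'
  rw [schwarzianWithin_univ]
  exact (hquot.continuous_deriv le_rfl).sub (continuous_const.mul (hquot.continuous.pow 2))

end IsCircleLift

theorem CircleDiff.schwarzian_coe {k : ℕ} {ψ : CircleDiff k} {F : ℝ → ℝ} (hF : IsCircleLift k F)
    (h : ∀ x : ℝ, ψ (x : Circ) = (F x : Circ)) (x : ℝ) :
    ψ.schwarzian (x : Circ) = schwarzianWithin univ F x := by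
  obtain ⟨n, hn⟩ := exists_lift_eq_add_int hF.continuous h
  rw [CircleDiff.schwarzian, circRep_coe, hn, schwarzianWithin_univ_add_const,
    periodic_apply_fract hF.periodic_schwarzianWithin]

/-- The potential `𝒮_F + 2 a (F'² - 1)`, which the density of orbital measures integrates along `φ`
against `φ'(τ)² dτ`. -/
noncomputable def orbitalPotential (a : ℝ) (F : ℝ → ℝ) (x : ℝ) : ℝ :=
  schwarzianWithin univ F x + 2 * a * (deriv F x ^ 2 - 1)

/-- The analogue of `orbitalPotential` for a diffeomorphism `g` of `[0, 1]`, with one-sided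
derivatives at the endpoints and extended `1`-periodically from `[0, 1)`. -/
noncomputable def pinnedPotential (a : ℝ) (g : ℝ → ℝ) (x : ℝ) : ℝ :=
  schwarzianWithin (Icc 0 1) g (Int.fract x)
    + 2 * a * (derivWithin g (Icc 0 1) (Int.fract x) ^ 2 - 1)

/-- The logarithmic derivative `g'' / g'` of `g'` on `[0, 1]`. -/
noncomputable def intervalLogDeriv (g : ℝ → ℝ) (x : ℝ) : ℝ :=
  iteratedDerivWithin 2 g (Icc 0 1) x / derivWithin g (Icc 0 1) x

/-- The jump `g''(0)/g'(0) - g''(1)/g'(1)` of the logarithmic derivative of `g'` at the point of the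
circle where the endpoints of `[0, 1]` are glued. -/
noncomputable def endpointJump (g : ℝ → ℝ) : ℝ := intervalLogDeriv g 0 - intervalLogDeriv g 1

theorem IsCircleLift.continuous_orbitalPotential {F : ℝ → ℝ} (hF : IsCircleLift 3 F) (a : ℝ) :
    Continuous (orbitalPotential a F) :=
  hF.continuous_schwarzianWithin.add
    (continuous_const.mul (((hF.continuous_deriv (by norm_num)).pow 2).sub continuous_const))

theorem orbitalDensity_eq (σ a : ℝ) {ψ : CircleDiff 3} {φ : CircleDiff 1} {F G : ℝ → ℝ}
    (hF : IsCircleLift 3 F) (hψ : ∀ x : ℝ, ψ (x : Circ) = (F x : Circ))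
    (hG : Continuous G) (hφ : ∀ x : ℝ, φ (x : Circ) = (G x : Circ)) (t : ℝ) :
    orbitalDensity σ a ψ φ = Real.exp (1 / σ ^ 2 *
      ∫ τ in t..t + 1, orbitalPotential a F (G τ) * deriv G τ ^ 2) := by
  rw [orbitalDensity, ← AddCircle.intervalIntegral_preimage 1 t]
  simp only [hφ, CircleDiff.deriv_coe hG hφ, CircleDiff.deriv_coe hF.continuous hψ,
    CircleDiff.schwarzian_coe hF hψ, orbitalPotential]

theorem orbitalDensity_rot_mul (σ a : ℝ) {ψ : CircleDiff 3} {φ : CircleDiff 1} {F G : ℝ → ℝ}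
    (hF : IsCircleLift 3 F) (hψ : ∀ x : ℝ, ψ (x : Circ) = (F x : Circ))
    (hG : Continuous G) (hφ : ∀ x : ℝ, φ (x : Circ) = (G x : Circ)) (t θ : ℝ) :
    orbitalDensity σ a ψ (CircleDiff.rot θ * φ) = Real.exp (1 / σ ^ 2 *
      ∫ τ in t..t + 1, orbitalPotential a F (G τ + θ) * deriv G τ ^ 2) := by
  have hrot (x : ℝ) : (CircleDiff.rot θ * φ) (x : Circ) = ((G x + θ : ℝ) : Circ) := by
    rw [CircleDiff.mul_apply, hφ, CircleDiff.rot_apply, AddCircle.coe_add]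
  have hGθ : Continuous fun x => G x + θ := hG.add continuous_const
  simp only [orbitalDensity_eq σ a hF hψ hGθ hrot t, deriv_add_const]

theorem continuous_orbitalDensity (σ a : ℝ) (ψ : CircleDiff 3) :
    Continuous (orbitalDensity σ a ψ) := by
  have hschwarzian : Continuous ψ.schwarzian := continuous_circ_iff.2 <| by
    simp only [CircleDiff.schwarzian_coe ψ.isCircleLift_lift ψ.coe_lift]
    exact ψ.isCircleLift_lift.continuous_schwarzianWithin
  have hderiv : Continuous ψ.deriv := continuous_circ_iff.2 <|
    ψ.isCircleLift_lift.continuous_deriv (by norm_num)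
  have hintegrand : Continuous fun p : CircleDiff 1 × Circ =>
      (ψ.schwarzian (p.1 p.2) + 2 * a * (ψ.deriv (p.1 p.2) ^ 2 - 1)) * p.1.deriv p.2 ^ 2 := by
    have := CircleDiff.continuous_eval
    have := CircleDiff.continuous_eval_deriv
    fun_prop
  exact Real.continuous_exp.comp (continuous_const.mul (continuousOn_univ.1
    (continuousOn_integral_of_compact_support isCompact_univ hintegrand.continuousOn
      fun _ _ _ h => (h trivial).elim)))

theorem measurable_ofReal_orbitalDensity (σ a : ℝ) (ψ : CircleDiff 3) :
    Measurable fun φ => ENNReal.ofReal (orbitalDensity σ a ψ φ) :=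
  (continuous_orbitalDensity σ a ψ).measurable.ennreal_ofReal

instance : NullSingletonClass (volume : Measure Circ) :=
  ⟨fun x => by rw [← Metric.closedBall_zero, AddCircle.volume_closedBall]; simp⟩

theorem pinnedDensity_eq (σ a : ℝ) (g : ℝ → ℝ) {φ : CircleDiff 1} {G : ℝ → ℝ}
    (hG : Continuous G) (hφ : ∀ x : ℝ, φ (x : Circ) = (G x : Circ)) (t₀ t : ℝ) :
    pinnedDensity σ a t₀ g φ =
      1 / Real.sqrt (derivWithin g (Icc 0 1) 0 * derivWithin g (Icc 0 1) 1) *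
        Real.exp (1 / σ ^ 2 * (endpointJump g * deriv G t₀
          + ∫ τ in t..t + 1, pinnedPotential a g (G τ) * deriv G τ ^ 2)) := by
  rw [pinnedDensity, restrict_compl_singleton, ← AddCircle.intervalIntegral_preimage 1 t,
    CircleDiff.deriv_coe hG hφ, mul_add, ← mul_assoc]
  simp only [hφ, CircleDiff.deriv_coe hG hφ, circRep_coe, pinnedPotential, endpointJump,
    intervalLogDeriv]

/-! ### Disintegration of orbital measures along rotations -/

theorem pullbackMeasure_eq_iff {f : CircleDiff 1} {μ ρ : Measure (CircleDiff 1)} :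
    pullbackMeasure f μ = ρ ↔ ρ.map (f * ·) = μ := by
  set e := (Homeomorph.mulLeft f).toMeasurableEquiv
  rw [show pullbackMeasure f μ = μ.map e.symm from (MeasurableEquiv.map_symm e).symm, eq_comm,
    ← MeasurableEquiv.map_apply_eq_iff_map_symm_apply_eq e]
  rfl

namespace CircleDiff

/-- The diffeomorphism `φ - φ(t₀)`: the representative modulo rotations of `φ` that maps `t₀`
to `0`. -/
noncomputable def pin (t₀ : Circ) (φ : CircleDiff 1) : CircleDiff 1 := rot (-φ t₀) * φ

theorem pin_rot_mul (t₀ θ : Circ) (φ : CircleDiff 1) : pin t₀ (rot θ * φ) = pin t₀ φ := by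
  rw [pin, pin, mul_apply, rot_apply, ← mul_assoc, rot_mul_rot]
  simp

theorem pin_eq_self {t₀ : Circ} {φ : CircleDiff 1} (h : φ t₀ = 0) : pin t₀ φ = φ := by
  rw [pin, h, neg_zero, rot_zero, one_mul]

theorem continuous_eval_const (t : Circ) : Continuous fun φ : CircleDiff 1 => φ t :=
  continuous_eval.comp (Continuous.prodMk_left t)

theorem continuous_pin (t₀ : Circ) : Continuous (pin t₀) :=
  (continuous_rot.comp (continuous_eval_const t₀).neg).mul continuous_id

theorem continuous_rot_mul : Continuous fun p : Circ × CircleDiff 1 => rot p.1 * p.2 :=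
  (continuous_rot.comp continuous_fst).mul continuous_snd

end CircleDiff

open CircleDiff (rot pin rot_zero rot_mul_rot mul_apply rot_apply continuous_pin
  continuous_rot_mul continuous_eval_const)

theorem pinnedMeasure_eq_map_pin (μ : Measure (CircleDiff 1)) (t₀ : Circ) :
    pinnedMeasure μ t₀ = μ.map (pin t₀) := rfl

theorem ae_pinnedMeasure_apply_eq_zero (μ : Measure (CircleDiff 1)) (t₀ : Circ) :
    ∀ᵐ φ ∂pinnedMeasure μ t₀, φ t₀ = 0 := by
  rw [pinnedMeasure_eq_map_pin, ae_map_iff (continuous_pin t₀).measurable.aemeasurable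
    (isClosed_eq (continuous_eval_const t₀) continuous_const).measurableSet]
  exact Eventually.of_forall fun φ => add_neg_cancel (φ t₀)

namespace IsOrbitalMeasure

variable {σ a : ℝ} {μ : Measure (CircleDiff 1)}

theorem sigmaFinite (hμ : IsOrbitalMeasure σ a μ) : SigmaFinite μ :=
  have := hμ.locallyFinite
  inferInstance

theorem lintegral_eq (hμ : IsOrbitalMeasure σ a μ) (ψ : CircleDiff 3)
    {h : CircleDiff 1 → ℝ≥0∞} (hh : Measurable h) :
    ∫⁻ φ, h φ ∂μ = ∫⁻ φ, ENNReal.ofReal (orbitalDensity σ a ψ φ) * h (ψ * φ) ∂μ := by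
  have hmul : Measurable fun φ => (ψ : CircleDiff 1) * φ := (continuous_const_mul _).measurable
  conv_lhs => rw [← pullbackMeasure_eq_iff.1 (hμ.pullback_eq ψ), lintegral_map hh hmul,
    lintegral_withDensity_eq_lintegral_mul _ (measurable_ofReal_orbitalDensity σ a ψ)
      (g := fun φ => h (ψ * φ)) (hh.comp hmul)]
  rfl

theorem map_rot_mul (hμ : IsOrbitalMeasure σ a μ) (θ : Circ) : μ.map (rot θ * ·) = μ := by
  obtain ⟨c, rfl⟩ := exists_coe_circ θ
  have hF : IsCircleLift 3 (fun x : ℝ => x + c) := (isCircleLift_id 3).add_const c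
  set ψ := CircleDiff.ofLift _ hF
  have hψ : ∀ x : ℝ, ψ (x : Circ) = ((x + c : ℝ) : Circ) := CircleDiff.ofLift_coe _ hF
  have hdensity : orbitalDensity σ a ψ = fun _ => 1 := by
    funext φ
    rw [orbitalDensity_eq σ a hF hψ φ.isCircleLift_lift.continuous φ.coe_lift 0]
    simp [orbitalPotential, schwarzianWithin_univ]
  have hrot : ψ.ofLE (by norm_num : 1 ≤ 3) = rot c := CircleDiff.ext_toFun fun t => by
    obtain ⟨x, rfl⟩ := exists_coe_circ t
    exact hψ x
  have hmap := pullbackMeasure_eq_iff.1 (hμ.pullback_eq ψ)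
  rw [hrot, hdensity] at hmap
  simpa using! hmap

theorem lintegral_eq_lintegral_pinned (hμ : IsOrbitalMeasure σ a μ) (t₀ : Circ)
    {h : CircleDiff 1 → ℝ≥0∞} (hh : Measurable h) :
    ∫⁻ φ, h φ ∂μ = ∫⁻ θ : Circ, ∫⁻ φ, h (rot θ * φ) ∂pinnedMeasure μ t₀ := by
  have := hμ.sigmaFinite
  have hm : Measurable fun p : Circ × CircleDiff 1 => h (rot p.1 * p.2) :=
    hh.comp continuous_rot_mul.measurable
  have hinvariant (θ : Circ) : ∫⁻ φ, h (rot θ * φ) ∂μ = ∫⁻ φ, h φ ∂μ := by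
    conv_rhs => rw [← hμ.map_rot_mul θ, lintegral_map hh (continuous_const_mul _).measurable]
  have hshift (φ : CircleDiff 1) :
      ∫⁻ θ : Circ, h (rot θ * pin t₀ φ) = ∫⁻ θ : Circ, h (rot θ * φ) := by
    simp only [pin, ← mul_assoc, rot_mul_rot]
    exact lintegral_add_left_eq_self (fun θ => h (rot θ * φ)) (-φ t₀)
  symm
  calc ∫⁻ θ : Circ, ∫⁻ φ, h (rot θ * φ) ∂pinnedMeasure μ t₀
      = ∫⁻ θ : Circ, ∫⁻ φ, h (rot θ * pin t₀ φ) ∂μ := lintegral_congr fun θ =>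
        lintegral_map (hm.comp measurable_prodMk_left) (continuous_pin t₀).measurable
    _ = ∫⁻ φ, (∫⁻ θ : Circ, h (rot θ * pin t₀ φ)) ∂μ := lintegral_lintegral_swap (hm.comp
        (measurable_fst.prodMk
          ((continuous_pin t₀).measurable.comp measurable_snd))).aemeasurable
    _ = ∫⁻ φ, (∫⁻ θ : Circ, h (rot θ * φ)) ∂μ := lintegral_congr hshift
    _ = ∫⁻ θ : Circ, ∫⁻ φ, h (rot θ * φ) ∂μ := (lintegral_lintegral_swap hm.aemeasurable).symm
    _ = ∫⁻ φ, h φ ∂μ := by simp [hinvariant]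

theorem volume_mul_pinnedMeasure_le (hμ : IsOrbitalMeasure σ a μ) (t₀ : Circ) {I : Set Circ}
    {U V : Set (CircleDiff 1)} (hI : MeasurableSet I) (hU : MeasurableSet U) (hV : MeasurableSet V)
    (hIV : ∀ θ ∈ I, ∀ φ ∈ V, rot θ * φ ∈ U) : volume I * pinnedMeasure μ t₀ V ≤ μ U := by
  calc volume I * pinnedMeasure μ t₀ V = ∫⁻ _ in I, ∫⁻ _ in V, 1 ∂pinnedMeasure μ t₀ := by
        rw [setLIntegral_one, setLIntegral_const, mul_comm]
    _ ≤ ∫⁻ θ in I, ∫⁻ φ in V, U.indicator 1 (rot θ * φ) ∂pinnedMeasure μ t₀ :=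
        setLIntegral_mono' hI fun θ hθ => setLIntegral_mono' hV fun φ hφ => by
          rw [indicator_of_mem (hIV θ hθ φ hφ), Pi.one_apply]
    _ ≤ ∫⁻ θ : Circ, ∫⁻ φ, U.indicator 1 (rot θ * φ) ∂pinnedMeasure μ t₀ :=
        (setLIntegral_le_lintegral _ _).trans
          (lintegral_mono fun _ => setLIntegral_le_lintegral _ _)
    _ = μ U := by
        rw [← hμ.lintegral_eq_lintegral_pinned t₀ (measurable_one.indicator hU),
          lintegral_indicator_one hU]

theorem isLocallyFiniteMeasure_pinned (hμ : IsOrbitalMeasure σ a μ) (t₀ : Circ) :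
    IsLocallyFiniteMeasure (pinnedMeasure μ t₀) := by
  have := hμ.locallyFinite
  refine ⟨fun φ => ?_⟩
  obtain ⟨U, hφU, hU, hμU⟩ := μ.exists_isOpen_measure_lt_top φ
  obtain ⟨I, V, hI, hV, h0I, hφV, hIV⟩ := isOpen_prod_iff.1
    (hU.preimage continuous_rot_mul) 0 φ (by rwa [mem_preimage, rot_zero, one_mul])
  have hle := hμ.volume_mul_pinnedMeasure_le t₀ hI.measurableSet hU.measurableSet hV.measurableSet
    fun θ hθ φ hφ => hIV (mk_mem_prod hθ hφ)
  exact ⟨V, hV.mem_nhds hφV, ENNReal.lt_top_of_mul_ne_top_right (hle.trans_lt hμU).ne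
    (hI.measure_pos volume ⟨0, h0I⟩).ne'⟩

theorem lintegral_eval_mul_pin (hμ : IsOrbitalMeasure σ a μ) (t₀ : Circ) {K : Circ → ℝ≥0∞}
    {H : CircleDiff 1 → ℝ≥0∞} (hK : Measurable K) (hH : Measurable H) :
    ∫⁻ φ, K (φ t₀) * H (pin t₀ φ) ∂μ = (∫⁻ θ, K θ) * ∫⁻ φ, H φ ∂pinnedMeasure μ t₀ := by
  rw [hμ.lintegral_eq_lintegral_pinned t₀ (h := fun φ => K (φ t₀) * H (pin t₀ φ))
    ((hK.comp (continuous_eval_const t₀).measurable).mul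
      (hH.comp (continuous_pin t₀).measurable)), ← lintegral_mul_const _ hK]
  refine lintegral_congr fun θ => ?_
  rw [← lintegral_const_mul _ hH]
  refine lintegral_congr_ae ?_
  filter_upwards [ae_pinnedMeasure_apply_eq_zero μ t₀] with φ hφ
  rw [CircleDiff.pin_rot_mul, CircleDiff.pin_eq_self hφ, mul_apply, rot_apply, hφ, zero_add]

theorem setLIntegral_deriv_mul_lintegral_pinned (hμ : IsOrbitalMeasure σ a μ) (t₀ : Circ)
    (ψ : CircleDiff 3) {H : CircleDiff 1 → ℝ≥0∞} (hH : Measurable H) {A : Set Circ}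
    (hA : MeasurableSet A) :
    ∫⁻ θ in A, ENNReal.ofReal ((ψ : CircleDiff 1).deriv θ) * ∫⁻ φ, H φ ∂pinnedMeasure μ t₀
      = ∫⁻ θ in A, ∫⁻ φ, ENNReal.ofReal (orbitalDensity σ a ψ (rot θ * φ))
          * H (pin t₀ (ψ * (rot θ * φ))) ∂pinnedMeasure μ t₀ := by
  set ψ₁ := (ψ : CircleDiff 1)
  have hdensity := measurable_ofReal_orbitalDensity σ a ψ
  have hK : Measurable fun θ : Circ => A.indicator (1 : Circ → ℝ≥0∞) (ψ₁⁻¹ θ) :=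
    (measurable_one.indicator hA).comp ψ₁⁻¹.continuous_coe.measurable
  have hKH : Measurable fun φ : CircleDiff 1 =>
      A.indicator (1 : Circ → ℝ≥0∞) (ψ₁⁻¹ (φ t₀)) * H (pin t₀ φ) :=
    (hK.comp (continuous_eval_const t₀).measurable).mul (hH.comp (continuous_pin t₀).measurable)
  have hpreimage (θ : Circ) {φ : CircleDiff 1} (hφ : φ t₀ = 0) :
      ψ₁⁻¹ ((ψ₁ * (rot θ * φ)) t₀) = θ := by
    rw [mul_apply, CircleDiff.inv_apply_self, mul_apply, rot_apply, hφ, zero_add]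
  calc ∫⁻ θ in A, ENNReal.ofReal (ψ₁.deriv θ) * ∫⁻ φ, H φ ∂pinnedMeasure μ t₀
      = (∫⁻ θ, A.indicator 1 (ψ₁⁻¹ θ)) * ∫⁻ φ, H φ ∂pinnedMeasure μ t₀ := by
        rw [lintegral_mul_const _ ψ₁.continuous_deriv.measurable.ennreal_ofReal,
          ψ₁.lintegral_comp_inv, ← lintegral_indicator hA]
        congr 1
        refine lintegral_congr fun θ => ?_
        by_cases hθ : θ ∈ A <;> simp [hθ]
    _ = ∫⁻ φ, A.indicator 1 (ψ₁⁻¹ (φ t₀)) * H (pin t₀ φ) ∂μ :=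
        (hμ.lintegral_eval_mul_pin t₀ hK hH).symm
    _ = ∫⁻ θ, ∫⁻ φ, ENNReal.ofReal (orbitalDensity σ a ψ (rot θ * φ))
          * (A.indicator 1 (ψ₁⁻¹ ((ψ₁ * (rot θ * φ)) t₀)) * H (pin t₀ (ψ₁ * (rot θ * φ))))
          ∂pinnedMeasure μ t₀ := by
        rw [hμ.lintegral_eq ψ hKH]
        exact hμ.lintegral_eq_lintegral_pinned t₀
          (hdensity.mul (hKH.comp (continuous_const_mul ψ₁).measurable))
    _ = ∫⁻ θ, ∫⁻ φ, A.indicator 1 θ * (ENNReal.ofReal (orbitalDensity σ a ψ (rot θ * φ))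
          * H (pin t₀ (ψ₁ * (rot θ * φ)))) ∂pinnedMeasure μ t₀ :=
        lintegral_congr fun θ => lintegral_congr_ae <| by
          filter_upwards [ae_pinnedMeasure_apply_eq_zero μ t₀] with φ hφ
          rw [hpreimage θ hφ, mul_left_comm]
    _ = ∫⁻ θ in A, ∫⁻ φ, ENNReal.ofReal (orbitalDensity σ a ψ (rot θ * φ))
          * H (pin t₀ (ψ₁ * (rot θ * φ))) ∂pinnedMeasure μ t₀ := by
        rw [← lintegral_indicator hA]
        refine lintegral_congr fun θ => ?_
        by_cases hθ : θ ∈ A <;> simp [hθ]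

/-- A diffeomorphism `ψ` acts on the factors of `μ = dθ ⊗ μ^{t₀}` by `θ ↦ ψ(θ)`, which has
Jacobian `ψ'(θ)`, and by the pinned map `rot (-ψ θ) * ψ * rot θ`. -/
theorem ae_deriv_mul_lintegral_pinned_eq (hμ : IsOrbitalMeasure σ a μ) (t₀ : Circ)
    (ψ : CircleDiff 3) {H : CircleDiff 1 → ℝ≥0∞} (hH : Measurable H) :
    ∀ᵐ θ : Circ, ENNReal.ofReal ((ψ : CircleDiff 1).deriv θ) * ∫⁻ φ, H φ ∂pinnedMeasure μ t₀
      = ∫⁻ φ, ENNReal.ofReal (orbitalDensity σ a ψ (rot θ * φ))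
          * H (rot (-(ψ : CircleDiff 1) θ) * ψ * rot θ * φ) ∂pinnedMeasure μ t₀ := by
  have := hμ.isLocallyFiniteMeasure_pinned t₀
  have hmeas : Measurable fun p : Circ × CircleDiff 1 =>
      ENNReal.ofReal (orbitalDensity σ a ψ (rot p.1 * p.2)) * H (pin t₀ (ψ * (rot p.1 * p.2))) :=
    ((measurable_ofReal_orbitalDensity σ a ψ).mul (hH.comp ((continuous_pin t₀).comp
      (continuous_const_mul (ψ : CircleDiff 1))).measurable)).comp continuous_rot_mul.measurable
  filter_upwards [ae_eq_of_forall_setLIntegral_eq_of_sigmaFinite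
    ((ψ : CircleDiff 1).continuous_deriv.measurable.ennreal_ofReal.mul_const _)
    hmeas.lintegral_prod_right' fun A hA _ =>
      hμ.setLIntegral_deriv_mul_lintegral_pinned t₀ ψ hH hA] with θ hθ
  refine hθ.trans (lintegral_congr_ae ?_)
  filter_upwards [ae_pinnedMeasure_apply_eq_zero μ t₀] with φ hφ
  simp only [pin, mul_apply, rot_apply, hφ, zero_add, mul_assoc]

end IsOrbitalMeasure

/-! ### Lifts `F` with prescribed `(F'' / F')'` -/

theorem hasDerivAt_primitive {v : ℝ → ℝ} (hv : Continuous v) (x : ℝ) :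
    HasDerivAt (fun x => ∫ y in 0..x, v y) (v x) x :=
  (hv.integral_hasStrictDerivAt 0 x).hasDerivAt

theorem contDiff_primitive {v : ℝ → ℝ} {n : ℕ} (hv : ContDiff ℝ n v) :
    ContDiff ℝ (n + 1 : ℕ) (fun x => ∫ y in 0..x, v y) := by
  have hderiv : deriv (fun x => ∫ y in 0..x, v y) = v :=
    funext fun x => (hasDerivAt_primitive hv.continuous x).deriv
  rw [Nat.cast_succ, contDiff_succ_iff_deriv, hderiv]
  exact ⟨fun x => (hasDerivAt_primitive hv.continuous x).differentiableAt, by simp, hv⟩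

theorem primitive_add_one {v : ℝ → ℝ} (hv : Continuous v) (hp : Function.Periodic v 1) (x : ℝ) :
    ∫ y in 0..x + 1, v y = (∫ y in 0..x, v y) + ∫ y in 0..1, v y := by
  simpa only [zero_add] using
    hp.intervalIntegral_add_eq_add 0 x fun _ _ => hv.intervalIntegrable _ _

/-- The primitive of `v` that has mean `0` over `[0, 1]`. -/
noncomputable def meanZeroPrimitive (v : ℝ → ℝ) (x : ℝ) : ℝ :=
  (∫ y in 0..x, v y) - ∫ z in 0..1, ∫ y in 0..z, v y

/-- The logarithm of the derivative of `liftOfLogDeriv v`, up to an additive constant. -/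
noncomputable def logDerivPrimitive (v : ℝ → ℝ) (x : ℝ) : ℝ := ∫ y in 0..x, meanZeroPrimitive v y

/-- The lift `F` of a circle diffeomorphism with `F 0 = 0` and `(F'' / F')' = v`, for a continuous
`1`-periodic function `v` of mean `0`. -/
noncomputable def liftOfLogDeriv (v : ℝ → ℝ) (x : ℝ) : ℝ :=
  (∫ y in 0..1, Real.exp (logDerivPrimitive v y))⁻¹ *
    ∫ y in 0..x, Real.exp (logDerivPrimitive v y)

section LiftOfLogDeriv

variable {v : ℝ → ℝ}

theorem contDiff_meanZeroPrimitive (hv : Continuous v) : ContDiff ℝ 1 (meanZeroPrimitive v) :=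
  ContDiff.sub (contDiff_primitive (n := 0) (contDiff_zero.2 hv)) contDiff_const

theorem continuous_meanZeroPrimitive (hv : Continuous v) : Continuous (meanZeroPrimitive v) :=
  (contDiff_meanZeroPrimitive hv).continuous

theorem hasDerivAt_meanZeroPrimitive (hv : Continuous v) (x : ℝ) :
    HasDerivAt (meanZeroPrimitive v) (v x) x :=
  (hasDerivAt_primitive hv x).sub_const _

theorem integral_meanZeroPrimitive (hv : Continuous v) :
    ∫ y in 0..1, meanZeroPrimitive v y = 0 := by
  have hprimitive : Continuous fun x => ∫ y in 0..x, v y :=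
    (contDiff_primitive (n := 0) (contDiff_zero.2 hv)).continuous
  simp only [meanZeroPrimitive]
  rw [intervalIntegral.integral_sub (hprimitive.intervalIntegrable _ _) (by simp)]
  simp

theorem periodic_meanZeroPrimitive (hv : Continuous v) (hp : Function.Periodic v 1)
    (h0 : ∫ y in 0..1, v y = 0) : Function.Periodic (meanZeroPrimitive v) 1 := fun x => by
  rw [meanZeroPrimitive, primitive_add_one hv hp, h0, add_zero, meanZeroPrimitive]

theorem contDiff_logDerivPrimitive (hv : Continuous v) : ContDiff ℝ 2 (logDerivPrimitive v) :=
  contDiff_primitive (n := 1) (contDiff_meanZeroPrimitive hv)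

theorem periodic_logDerivPrimitive (hv : Continuous v) (hp : Function.Periodic v 1)
    (h0 : ∫ y in 0..1, v y = 0) : Function.Periodic (logDerivPrimitive v) 1 := fun x => by
  rw [logDerivPrimitive, primitive_add_one (continuous_meanZeroPrimitive hv)
    (periodic_meanZeroPrimitive hv hp h0), integral_meanZeroPrimitive hv, add_zero,
    logDerivPrimitive]

theorem integral_exp_pos {L : ℝ → ℝ} (hL : ContinuousOn L (Icc 0 1)) :
    0 < ∫ y in 0..1, Real.exp (L y) :=
  intervalIntegral.intervalIntegral_pos_of_pos
    (hL.rexp.intervalIntegrable_of_Icc zero_le_one) (fun _ => Real.exp_pos _) one_pos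

theorem integral_exp_logDerivPrimitive_pos (hv : Continuous v) :
    0 < ∫ y in 0..1, Real.exp (logDerivPrimitive v y) :=
  integral_exp_pos (contDiff_logDerivPrimitive hv).continuous.continuousOn

theorem deriv_liftOfLogDeriv (hv : Continuous v) :
    deriv (liftOfLogDeriv v) = fun x => (∫ y in 0..1, Real.exp (logDerivPrimitive v y))⁻¹ *
      Real.exp (logDerivPrimitive v x) :=
  funext fun x =>
    ((hasDerivAt_primitive (contDiff_logDerivPrimitive hv).exp.continuous x).const_mul _).deriv

theorem liftOfLogDeriv_zero (v : ℝ → ℝ) : liftOfLogDeriv v 0 = 0 := by simp [liftOfLogDeriv]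

theorem isCircleLift_liftOfLogDeriv (hv : Continuous v) (hp : Function.Periodic v 1)
    (h0 : ∫ y in 0..1, v y = 0) : IsCircleLift 3 (liftOfLogDeriv v) where
  contDiff := contDiff_const.mul (contDiff_primitive (n := 2) (contDiff_logDerivPrimitive hv).exp)
  deriv_pos x := by
    rw [deriv_liftOfLogDeriv hv]
    exact mul_pos (inv_pos.2 (integral_exp_logDerivPrimitive_pos hv)) (Real.exp_pos _)
  add_one x := by
    have hperiodic : Function.Periodic (fun x => Real.exp (logDerivPrimitive v x)) 1 := fun x => by
      simp only [periodic_logDerivPrimitive hv hp h0 x]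
    rw [liftOfLogDeriv, primitive_add_one (contDiff_logDerivPrimitive hv).exp.continuous hperiodic,
      mul_add, inv_mul_cancel₀ (integral_exp_logDerivPrimitive_pos hv).ne', liftOfLogDeriv]

theorem schwarzianWithin_liftOfLogDeriv (hv : Continuous v) (x : ℝ) :
    schwarzianWithin univ (liftOfLogDeriv v) x = v x - 1 / 2 * meanZeroPrimitive v x ^ 2 := by
  have hL (x : ℝ) : HasDerivAt (logDerivPrimitive v) (meanZeroPrimitive v x) x :=
    hasDerivAt_primitive (continuous_meanZeroPrimitive hv) x
  have hc := (integral_exp_logDerivPrimitive_pos hv).ne'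
  have hlogDeriv (y : ℝ) : deriv (deriv (liftOfLogDeriv v)) y / deriv (liftOfLogDeriv v) y
      = meanZeroPrimitive v y := by
    rw [deriv_liftOfLogDeriv hv, ((hL y).exp.const_mul _).deriv]
    field_simp
  simp only [schwarzianWithin_univ, hlogDeriv, (hasDerivAt_meanZeroPrimitive hv x).deriv]

end LiftOfLogDeriv

/-- The hat function with value `1` at `0` that vanishes on `[δ, ∞)`. -/
noncomputable def hat (δ x : ℝ) : ℝ := max 0 (1 - x / δ)

/-- A continuous `1`-periodic bump of mass `1` around the integers. -/
noncomputable def bump (δ x : ℝ) : ℝ :=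
  δ⁻¹ * (hat δ (Int.fract x) + hat δ (1 - Int.fract x))

/-- A continuous `1`-periodic function that agrees with `u` on `[δ, 1 - δ]`, even if
`u 0 ≠ u 1`. -/
noncomputable def endpointMatch (u : ℝ → ℝ) (δ x : ℝ) : ℝ :=
  u (Int.fract x) + (u 1 - u 0) / 2 * (hat δ (Int.fract x) - hat δ (1 - Int.fract x))

section Bump

variable {δ : ℝ}

@[fun_prop]
theorem continuous_hat (δ : ℝ) : Continuous (hat δ) := by unfold hat; fun_prop

theorem hat_nonneg (δ x : ℝ) : 0 ≤ hat δ x := le_max_left _ _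

theorem hat_zero (δ : ℝ) : hat δ 0 = 1 := by simp [hat]

theorem hat_eq_zero {x : ℝ} (hδ : 0 < δ) (hx : δ ≤ x) : hat δ x = 0 :=
  max_eq_left (by rw [sub_nonpos, one_le_div hδ]; exact hx)

theorem hat_le_one {x : ℝ} (hδ : 0 < δ) (hx : 0 ≤ x) : hat δ x ≤ 1 :=
  max_le zero_le_one (sub_le_self _ (div_nonneg hx hδ.le))

theorem hasDerivAt_max_zero_sq (y : ℝ) : HasDerivAt (fun y : ℝ => max 0 y ^ 2) (2 * max 0 y) y := by
  rcases lt_trichotomy y 0 with hy | rfl | hy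
  · rw [max_eq_left hy.le, mul_zero]
    refine (hasDerivAt_const y 0).congr_of_eventuallyEq ?_
    filter_upwards [gt_mem_nhds hy] with z hz
    simp [max_eq_left hz.le]
  · rw [hasDerivAt_iff_isLittleO_nhds_zero]
    simp only [zero_add, max_self, mul_zero, smul_eq_mul, ne_eq, OfNat.ofNat_ne_zero,
      not_false_eq_true, zero_pow, sub_zero]
    refine (Asymptotics.IsBigO.of_bound' (Eventually.of_forall fun h => ?_)).trans_isLittleO
      (Asymptotics.isLittleO_pow_id (𝕜 := ℝ) one_lt_two)
    rw [norm_pow, norm_pow]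
    exact pow_le_pow_left₀ (norm_nonneg _)
      (by simpa using abs_max_le_max_abs_abs (a := 0) (b := h)) 2
  · rw [max_eq_right hy.le]
    have hsq : HasDerivAt (fun z : ℝ => z ^ 2) (2 * y) y := by simpa using hasDerivAt_pow 2 y
    refine hsq.congr_of_eventuallyEq ?_
    filter_upwards [lt_mem_nhds hy] with z hz
    rw [max_eq_right hz.le]

theorem integral_hat (hδ : 0 < δ) (x y : ℝ) :
    ∫ t in x..y, hat δ t = δ / 2 * (hat δ x ^ 2 - hat δ y ^ 2) := by
  have hderiv (t : ℝ) : HasDerivAt (fun t => -(δ / 2) * hat δ t ^ 2) (hat δ t) t := by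
    have hinner : HasDerivAt (fun t => 1 - t / δ) (-(1 / δ)) t :=
      ((hasDerivAt_id t).div_const δ).const_sub 1
    refine (((hasDerivAt_max_zero_sq _).comp t hinner).const_mul (-(δ / 2))).congr_deriv ?_
    rw [hat]
    field_simp
  rw [intervalIntegral.integral_eq_sub_of_hasDerivAt (fun t _ => hderiv t)
    ((continuous_hat δ).intervalIntegrable _ _)]
  ring

theorem integral_hat_one_sub (hδ : 0 < δ) (hδ1 : δ ≤ 1) (x : ℝ) :
    ∫ y in 0..x, hat δ (1 - y) = δ / 2 * hat δ (1 - x) ^ 2 := by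
  rw [intervalIntegral.integral_comp_sub_left (hat δ) 1, sub_zero, integral_hat hδ,
    hat_eq_zero hδ hδ1]
  ring

theorem apply_fract_of_mem_Icc {X : Type*} {f : ℝ → X} (h : f 0 = f 1) {x : ℝ}
    (hx : x ∈ Icc (0 : ℝ) 1) : f (Int.fract x) = f x := by
  rcases hx.2.lt_or_eq with hx1 | rfl
  · rw [Int.fract_eq_self.2 ⟨hx.1, hx1⟩]
  · rw [Int.fract_one, h]

theorem fract_mem_Icc (x : ℝ) : Int.fract x ∈ Icc (0 : ℝ) 1 :=
  ⟨Int.fract_nonneg x, (Int.fract_lt_one x).le⟩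

theorem bump_of_mem {x : ℝ} (hx : x ∈ Icc (0 : ℝ) 1) :
    bump δ x = δ⁻¹ * (hat δ x + hat δ (1 - x)) :=
  apply_fract_of_mem_Icc (f := fun x => δ⁻¹ * (hat δ x + hat δ (1 - x)))
    (by simp only [sub_zero, sub_self]; ring) hx

@[fun_prop]
theorem continuous_bump (δ : ℝ) : Continuous (bump δ) :=
  ContinuousOn.comp_fract'' (f := fun x => δ⁻¹ * (hat δ x + hat δ (1 - x)))
    (Continuous.continuousOn (by fun_prop)) (by simp only [sub_zero, sub_self]; ring)

theorem periodic_bump (δ : ℝ) : Function.Periodic (bump δ) 1 := fun x => by simp [bump]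

theorem bump_nonneg (hδ : 0 < δ) (x : ℝ) : 0 ≤ bump δ x :=
  mul_nonneg (inv_nonneg.2 hδ.le) (add_nonneg (hat_nonneg _ _) (hat_nonneg _ _))

theorem mul_bump_le (hδ : 0 < δ) (x : ℝ) : δ * bump δ x ≤ 2 := by
  rw [bump, mul_inv_cancel_left₀ hδ.ne']
  linarith [hat_le_one hδ (fract_mem_Icc x).1, hat_le_one hδ (sub_nonneg.2 (fract_mem_Icc x).2)]

theorem bump_eq_zero (hδ : 0 < δ) {x : ℝ} (hx : Int.fract x ∈ Icc δ (1 - δ)) : bump δ x = 0 := by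
  rw [bump, hat_eq_zero hδ hx.1, hat_eq_zero hδ (by linarith [hx.2]), add_zero, mul_zero]

theorem integral_bump_of_mem (hδ : 0 < δ) (hδ1 : δ ≤ 1) {x : ℝ} (hx : x ∈ Icc (0 : ℝ) 1) :
    ∫ y in 0..x, bump δ y = (1 - hat δ x ^ 2 + hat δ (1 - x) ^ 2) / 2 := by
  have hcongr : ∫ y in 0..x, bump δ y = ∫ y in 0..x, δ⁻¹ * (hat δ y + hat δ (1 - y)) := by
    refine intervalIntegral.integral_congr fun y hy => ?_
    rw [uIcc_of_le hx.1] at hy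
    exact bump_of_mem ⟨hy.1, hy.2.trans hx.2⟩
  rw [hcongr, intervalIntegral.integral_const_mul, intervalIntegral.integral_add
    (Continuous.intervalIntegrable (by fun_prop) _ _)
    (Continuous.intervalIntegrable (by fun_prop) _ _),
    integral_hat hδ, integral_hat_one_sub hδ hδ1, hat_zero]
  field_simp

theorem integral_bump (hδ : 0 < δ) (hδ1 : δ ≤ 1) : ∫ y in 0..1, bump δ y = 1 := by
  rw [integral_bump_of_mem hδ hδ1 (by simp), hat_eq_zero hδ hδ1, sub_self, hat_zero]
  norm_num

theorem integral_bump_le_one (hδ : 0 < δ) (hδ1 : δ ≤ 1) {x : ℝ} (hx : x ∈ Icc (0 : ℝ) 1) :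
    ∫ y in 0..x, bump δ y ≤ 1 := by
  rw [← integral_bump hδ hδ1]
  exact intervalIntegral.integral_mono_interval le_rfl hx.1 hx.2
    (Eventually.of_forall fun y => bump_nonneg hδ y)
    ((continuous_bump δ).intervalIntegrable _ _)

theorem endpointMatch_ends {u : ℝ → ℝ} (hδ : 0 < δ) (hδ1 : δ ≤ 1) :
    u 0 + (u 1 - u 0) / 2 * (hat δ 0 - hat δ (1 - 0))
      = u 1 + (u 1 - u 0) / 2 * (hat δ 1 - hat δ (1 - 1)) := by
  rw [sub_zero, sub_self, hat_zero, hat_eq_zero hδ hδ1]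
  ring

theorem endpointMatch_of_mem {u : ℝ → ℝ} (hδ : 0 < δ) (hδ1 : δ ≤ 1) {x : ℝ}
    (hx : x ∈ Icc (0 : ℝ) 1) :
    endpointMatch u δ x = u x + (u 1 - u 0) / 2 * (hat δ x - hat δ (1 - x)) :=
  apply_fract_of_mem_Icc (f := fun x => u x + (u 1 - u 0) / 2 * (hat δ x - hat δ (1 - x)))
    (endpointMatch_ends hδ hδ1) hx

theorem continuous_endpointMatch {u : ℝ → ℝ} (hu : ContinuousOn u (Icc 0 1)) (hδ : 0 < δ)
    (hδ1 : δ ≤ 1) : Continuous (endpointMatch u δ) :=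
  ContinuousOn.comp_fract''
    (f := fun x => u x + (u 1 - u 0) / 2 * (hat δ x - hat δ (1 - x)))
    (hu.add (Continuous.continuousOn (by fun_prop))) (endpointMatch_ends hδ hδ1)

theorem periodic_endpointMatch (u : ℝ → ℝ) (δ : ℝ) : Function.Periodic (endpointMatch u δ) 1 :=
  fun x => by simp [endpointMatch]

theorem endpointMatch_eq {u : ℝ → ℝ} (hδ : 0 < δ) {x : ℝ} (hx : Int.fract x ∈ Icc δ (1 - δ)) :
    endpointMatch u δ x = u (Int.fract x) := by
  rw [endpointMatch, hat_eq_zero hδ hx.1, hat_eq_zero hδ (by linarith [hx.2]), sub_self, mul_zero,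
    add_zero]

theorem abs_endpointMatch_le {u : ℝ → ℝ} (hδ : 0 < δ) {M : ℝ} (hM : ∀ x ∈ Icc (0 : ℝ) 1, |u x| ≤ M)
    (x : ℝ) : |endpointMatch u δ x| ≤ 2 * M := by
  have hx := fract_mem_Icc x
  have hjump : |(u 1 - u 0) / 2| ≤ M := by
    have h0 := hM 0 (by simp)
    have h1 := hM 1 (by simp)
    rw [abs_le] at *
    constructor <;> linarith
  have hhat : |hat δ (Int.fract x) - hat δ (1 - Int.fract x)| ≤ 1 :=
    abs_sub_le_of_nonneg_of_le (hat_nonneg _ _) (hat_le_one hδ hx.1) (hat_nonneg _ _)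
      (hat_le_one hδ (sub_nonneg.2 hx.2))
  calc |endpointMatch u δ x| ≤ |u (Int.fract x)|
          + |(u 1 - u 0) / 2| * |hat δ (Int.fract x) - hat δ (1 - Int.fract x)| := by
        rw [← abs_mul]
        exact abs_add_le _ _
    _ ≤ M + M * 1 := add_le_add (hM _ hx)
        (mul_le_mul hjump hhat (abs_nonneg _) ((abs_nonneg _).trans hjump))
    _ = 2 * M := by ring

theorem integral_endpointMatch {u : ℝ → ℝ} (hu : ContinuousOn u (Icc 0 1)) (hδ : 0 < δ)
    (hδ1 : δ ≤ 1) {x : ℝ} (hx : x ∈ Icc (0 : ℝ) 1) :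
    ∫ y in 0..x, endpointMatch u δ y = (∫ y in 0..x, u y)
      + (u 1 - u 0) * δ / 4 * (1 - hat δ x ^ 2 - hat δ (1 - x) ^ 2) := by
  have hcongr : ∫ y in 0..x, endpointMatch u δ y
      = ∫ y in 0..x, (u y + (u 1 - u 0) / 2 * (hat δ y - hat δ (1 - y))) := by
    refine intervalIntegral.integral_congr fun y hy => ?_
    rw [uIcc_of_le hx.1] at hy
    exact endpointMatch_of_mem hδ hδ1 ⟨hy.1, hy.2.trans hx.2⟩
  rw [hcongr, intervalIntegral.integral_add
    ((hu.mono (Icc_subset_Icc_right hx.2)).intervalIntegrable_of_Icc hx.1)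
    (Continuous.intervalIntegrable (by fun_prop) _ _),
    intervalIntegral.integral_const_mul, intervalIntegral.integral_sub
    (Continuous.intervalIntegrable (by fun_prop) _ _)
    (Continuous.intervalIntegrable (by fun_prop) _ _), integral_hat hδ,
    integral_hat_one_sub hδ hδ1, hat_zero]
  ring

end Bump

theorem eq_add_integral_derivWithin {f : ℝ → ℝ} (hf : ContDiffOn ℝ 1 f (Icc 0 1)) {x : ℝ}
    (hx : x ∈ Icc (0 : ℝ) 1) : f x = f 0 + ∫ y in 0..x, derivWithin f (Icc 0 1) y := by
  have hsub : Icc 0 x ⊆ Icc (0 : ℝ) 1 := Icc_subset_Icc_right hx.2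
  have hderiv : ContinuousOn (derivWithin f (Icc 0 1)) (Icc 0 1) :=
    hf.continuousOn_derivWithin (uniqueDiffOn_Icc zero_lt_one) le_rfl
  rw [intervalIntegral.integral_eq_sub_of_hasDerivAt_of_le hx.1 (hf.continuousOn.mono hsub)
    (fun y hy => ((hf.differentiableOn one_ne_zero) y
      (hsub ⟨hy.1.le, hy.2.le⟩)).hasDerivWithinAt.hasDerivAt
        (Icc_mem_nhds hy.1 (hy.2.trans_le hx.2)))
    ((hderiv.mono hsub).intervalIntegrable_of_Icc hx.1)]
  ring

/-- A continuous `1`-periodic approximation of the derivative of the `1`-periodic extension of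
`w : [0, 1] → ℝ`, in which a bump of mass `w 0 - w 1` replaces the jump at the integers. -/
noncomputable def smoothedDeriv (w : ℝ → ℝ) (δ x : ℝ) : ℝ :=
  endpointMatch (derivWithin w (Icc 0 1)) δ x + (w 0 - w 1) * bump δ x

/-- The failure of `w : [0, 1] → ℝ` to have a `C¹` periodic extension. It controls the error
of the approximation `smoothedDeriv w δ`. -/
noncomputable def endpointGap (w : ℝ → ℝ) : ℝ :=
  |derivWithin w (Icc 0 1) 1 - derivWithin w (Icc 0 1) 0| + |w 0 - w 1|

theorem endpointGap_nonneg (w : ℝ → ℝ) : 0 ≤ endpointGap w :=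
  add_nonneg (abs_nonneg _) (abs_nonneg _)

section SmoothedDeriv

variable {w : ℝ → ℝ} {δ : ℝ}

theorem continuous_smoothedDeriv (hw : ContDiffOn ℝ 1 w (Icc 0 1)) (hδ : 0 < δ) (hδ1 : δ ≤ 1) :
    Continuous (smoothedDeriv w δ) :=
  (continuous_endpointMatch (hw.continuousOn_derivWithin (uniqueDiffOn_Icc zero_lt_one) le_rfl)
    hδ hδ1).add (continuous_const.mul (continuous_bump δ))

theorem periodic_smoothedDeriv (w : ℝ → ℝ) (δ : ℝ) : Function.Periodic (smoothedDeriv w δ) 1 :=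
  fun x => by rw [smoothedDeriv, periodic_endpointMatch, periodic_bump, smoothedDeriv]

theorem integral_smoothedDeriv_of_mem (hw : ContDiffOn ℝ 1 w (Icc 0 1)) (hδ : 0 < δ)
    (hδ1 : δ ≤ 1) {x : ℝ} (hx : x ∈ Icc (0 : ℝ) 1) :
    ∫ y in 0..x, smoothedDeriv w δ y = w x - w 0
      + (derivWithin w (Icc 0 1) 1 - derivWithin w (Icc 0 1) 0) * δ / 4
        * (1 - hat δ x ^ 2 - hat δ (1 - x) ^ 2)
      + (w 0 - w 1) * ((1 - hat δ x ^ 2 + hat δ (1 - x) ^ 2) / 2) := by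
  have hw₁ := hw.continuousOn_derivWithin (uniqueDiffOn_Icc zero_lt_one) le_rfl
  simp only [smoothedDeriv]
  rw [intervalIntegral.integral_add
    ((continuous_endpointMatch hw₁ hδ hδ1).intervalIntegrable _ _)
    (((continuous_bump δ).intervalIntegrable _ _).const_mul _),
    intervalIntegral.integral_const_mul, integral_endpointMatch hw₁ hδ hδ1 hx,
    integral_bump_of_mem hδ hδ1 hx]
  linear_combination -(eq_add_integral_derivWithin hw hx)

theorem integral_smoothedDeriv (hw : ContDiffOn ℝ 1 w (Icc 0 1)) (hδ : 0 < δ) (hδ1 : δ ≤ 1) :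
    ∫ y in 0..1, smoothedDeriv w δ y = 0 := by
  rw [integral_smoothedDeriv_of_mem hw hδ hδ1 (by simp), hat_eq_zero hδ hδ1, sub_self, hat_zero]
  ring

theorem abs_integral_smoothedDeriv_sub_le (hw : ContDiffOn ℝ 1 w (Icc 0 1)) (hδ : 0 < δ)
    (hδ1 : δ ≤ 1) {x : ℝ} (hx : x ∈ Icc (0 : ℝ) 1) :
    |(∫ y in 0..x, smoothedDeriv w δ y) - (w x - (w 0 + w 1) / 2)|
      ≤ endpointGap w * δ / 2 * (1 + bump δ x) := by
  rw [integral_smoothedDeriv_of_mem hw hδ hδ1 hx, bump_of_mem hx]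
  set c := derivWithin w (Icc 0 1) 1 - derivWithin w (Icc 0 1) 0 with hc
  have hp0 := hat_nonneg δ x
  have hq0 := hat_nonneg δ (1 - x)
  have hp1 := hat_le_one hδ hx.1
  have hq1 := hat_le_one hδ (sub_nonneg.2 hx.2)
  set p := hat δ x
  set q := hat δ (1 - x)
  have hsum : |1 - p ^ 2 - q ^ 2| ≤ 1 := by rw [abs_le]; constructor <;> nlinarith
  have hdiff : |q ^ 2 - p ^ 2| ≤ p + q := by rw [abs_le]; constructor <;> nlinarith
  calc _ = |c * (δ / 4) * (1 - p ^ 2 - q ^ 2) + (w 0 - w 1) / 2 * (q ^ 2 - p ^ 2)| := by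
        congr 1
        ring
    _ ≤ |c| * (δ / 4) * 1 + |w 0 - w 1| / 2 * (p + q) := by
        refine (abs_add_le _ _).trans ?_
        rw [abs_mul, abs_mul, abs_mul, abs_of_pos (by positivity : 0 < δ / 4), abs_div, abs_two]
        gcongr
    _ ≤ (|c| + |w 0 - w 1|) / 2 * (δ + (p + q)) := by
        nlinarith [abs_nonneg c, abs_nonneg (w 0 - w 1), mul_nonneg (abs_nonneg c) hδ.le,
          mul_nonneg (abs_nonneg (w 0 - w 1)) hδ.le, mul_nonneg (abs_nonneg c) (add_nonneg hp0 hq0)]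
    _ = endpointGap w * δ / 2 * (1 + δ⁻¹ * (p + q)) := by
        rw [endpointGap, ← hc]
        field_simp

theorem abs_meanZeroPrimitive_smoothedDeriv_sub_le (hw : ContDiffOn ℝ 1 w (Icc 0 1))
    (hw0 : ∫ y in 0..1, w y = 0) (hδ : 0 < δ) (hδ1 : δ ≤ 1) {x : ℝ} (hx : x ∈ Icc (0 : ℝ) 1) :
    |meanZeroPrimitive (smoothedDeriv w δ) x - w x| ≤ endpointGap w * δ * (2 + bump δ x) := by
  set P : ℝ → ℝ := fun z => ∫ y in 0..z, smoothedDeriv w δ y with hP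
  have hPc : Continuous P :=
    (contDiff_primitive (n := 0) (contDiff_zero.2 (continuous_smoothedDeriv hw hδ hδ1))).continuous
  have hwi : IntervalIntegrable w volume 0 1 :=
    hw.continuousOn.intervalIntegrable_of_Icc zero_le_one
  have herror : |∫ z in 0..1, (P z - (w z - (w 0 + w 1) / 2))| ≤ endpointGap w * δ := by
    rw [← Real.norm_eq_abs]
    calc _ ≤ ∫ z in 0..1, endpointGap w * δ / 2 * (1 + bump δ z) :=
          intervalIntegral.norm_integral_le_of_norm_le zero_le_one
            (Eventually.of_forall fun z hz =>
              abs_integral_smoothedDeriv_sub_le hw hδ hδ1 (Ioc_subset_Icc_self hz))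
            (Continuous.intervalIntegrable (by fun_prop) _ _)
      _ = endpointGap w * δ := by
          rw [intervalIntegral.integral_const_mul, intervalIntegral.integral_add (by simp)
            ((continuous_bump δ).intervalIntegrable _ _), integral_bump hδ hδ1]
          simp only [intervalIntegral.integral_const, sub_zero, smul_eq_mul, mul_one]
          ring
  have hmean : ∫ z in 0..1, (P z - (w z - (w 0 + w 1) / 2))
      = (∫ z in 0..1, P z) + (w 0 + w 1) / 2 := by
    rw [intervalIntegral.integral_sub (hPc.intervalIntegrable _ _) (hwi.sub (by simp)),
      intervalIntegral.integral_sub hwi (by simp), hw0]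
    simp
  calc |meanZeroPrimitive (smoothedDeriv w δ) x - w x|
      = |(P x - (w x - (w 0 + w 1) / 2)) - ∫ z in 0..1, (P z - (w z - (w 0 + w 1) / 2))| := by
        rw [hmean, meanZeroPrimitive]
        congr 1
        simp only [hP]
        ring
    _ ≤ endpointGap w * δ / 2 * (1 + bump δ x) + endpointGap w * δ :=
        (abs_sub _ _).trans
          (add_le_add (abs_integral_smoothedDeriv_sub_le hw hδ hδ1 hx) herror)
    _ ≤ endpointGap w * δ * (2 + bump δ x) := by
        nlinarith [mul_nonneg (mul_nonneg (endpointGap_nonneg w) hδ.le) (bump_nonneg hδ x),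
          mul_nonneg (endpointGap_nonneg w) hδ.le]

theorem abs_logDerivPrimitive_smoothedDeriv_sub_le (hw : ContDiffOn ℝ 1 w (Icc 0 1))
    (hw0 : ∫ y in 0..1, w y = 0) (hδ : 0 < δ) (hδ1 : δ ≤ 1) {x : ℝ} (hx : x ∈ Icc (0 : ℝ) 1) :
    |logDerivPrimitive (smoothedDeriv w δ) x - ∫ y in 0..x, w y| ≤ 3 * (endpointGap w * δ) := by
  have hsub : Icc 0 x ⊆ Icc (0 : ℝ) 1 := Icc_subset_Icc_right hx.2
  have hgap : 0 ≤ endpointGap w * δ := mul_nonneg (endpointGap_nonneg w) hδ.le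
  rw [logDerivPrimitive, ← Real.norm_eq_abs, ← intervalIntegral.integral_sub
    ((continuous_meanZeroPrimitive (continuous_smoothedDeriv hw hδ hδ1)).intervalIntegrable _ _)
    ((hw.continuousOn.mono hsub).intervalIntegrable_of_Icc hx.1)]
  calc _ ≤ ∫ y in 0..x, endpointGap w * δ * (2 + bump δ y) :=
        intervalIntegral.norm_integral_le_of_norm_le hx.1
          (Eventually.of_forall fun y hy => abs_meanZeroPrimitive_smoothedDeriv_sub_le hw hw0 hδ
            hδ1 (hsub (Ioc_subset_Icc_self hy)))
          (Continuous.intervalIntegrable (by fun_prop) _ _)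
    _ = endpointGap w * δ * (2 * x + ∫ y in 0..x, bump δ y) := by
        rw [intervalIntegral.integral_const_mul, intervalIntegral.integral_add (by simp)
          ((continuous_bump δ).intervalIntegrable _ _)]
        simp only [intervalIntegral.integral_const, sub_zero, smul_eq_mul]
        ring
    _ ≤ endpointGap w * δ * 3 :=
        mul_le_mul_of_nonneg_left (by linarith [hx.2, integral_bump_le_one hδ hδ1 hx]) hgap
    _ = 3 * (endpointGap w * δ) := mul_comm _ _

theorem periodic_meanZeroPrimitive_smoothedDeriv (hw : ContDiffOn ℝ 1 w (Icc 0 1)) (hδ : 0 < δ)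
    (hδ1 : δ ≤ 1) : Function.Periodic (meanZeroPrimitive (smoothedDeriv w δ)) 1 :=
  periodic_meanZeroPrimitive (continuous_smoothedDeriv hw hδ hδ1) (periodic_smoothedDeriv w δ)
    (integral_smoothedDeriv hw hδ hδ1)

theorem abs_meanZeroPrimitive_smoothedDeriv_le (hw : ContDiffOn ℝ 1 w (Icc 0 1))
    (hw0 : ∫ y in 0..1, w y = 0) (hδ : 0 < δ) (hδ1 : δ ≤ 1) {N : ℝ}
    (hN : ∀ x ∈ Icc (0 : ℝ) 1, |w x| ≤ N) (x : ℝ) :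
    |meanZeroPrimitive (smoothedDeriv w δ) x| ≤ N + 4 * endpointGap w := by
  have hx := fract_mem_Icc x
  rw [← periodic_apply_fract (periodic_meanZeroPrimitive_smoothedDeriv hw hδ hδ1)]
  set y := Int.fract x
  calc |meanZeroPrimitive (smoothedDeriv w δ) y|
      ≤ |w y| + |meanZeroPrimitive (smoothedDeriv w δ) y - w y| := by
        simpa using abs_add_le (w y) (meanZeroPrimitive (smoothedDeriv w δ) y - w y)
    _ ≤ N + endpointGap w * δ * (2 + bump δ y) :=
        add_le_add (hN y hx) (abs_meanZeroPrimitive_smoothedDeriv_sub_le hw hw0 hδ hδ1 hx)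
    _ = N + endpointGap w * (2 * δ + δ * bump δ y) := by ring
    _ ≤ N + endpointGap w * 4 := by
        gcongr
        · exact endpointGap_nonneg w
        · linarith [mul_bump_le hδ y]
    _ = N + 4 * endpointGap w := by ring

end SmoothedDeriv

/-! ### Diffeomorphisms of the interval -/

namespace IsIntervalDiff

variable {k : ℕ} {g : ℝ → ℝ}

theorem contDiffOn_derivWithin (hg : IsIntervalDiff (k + 1) g) :
    ContDiffOn ℝ k (derivWithin g (Icc 0 1)) (Icc 0 1) :=
  hg.contDiffOn.derivWithin (uniqueDiffOn_Icc zero_lt_one) (by norm_num)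

theorem contDiffOn_intervalLogDeriv (hg : IsIntervalDiff (k + 2) g) :
    ContDiffOn ℝ k (intervalLogDeriv g) (Icc 0 1) := by
  have hg' : ContDiffOn ℝ (k + 1 : ℕ) (derivWithin g (Icc 0 1)) (Icc 0 1) :=
    hg.contDiffOn_derivWithin
  have hg'' : ContDiffOn ℝ k (iteratedDerivWithin 2 g (Icc 0 1)) (Icc 0 1) := by
    rw [iteratedDerivWithin_succ', iteratedDerivWithin_one]
    exact hg'.derivWithin (uniqueDiffOn_Icc zero_lt_one) (by norm_num)
  exact hg''.div (hg'.of_le (by norm_num)) fun x hx => (hg.deriv_pos x hx).ne'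

theorem derivWithin_eq_mul_exp (hg : IsIntervalDiff (k + 2) g) {x : ℝ}
    (hx : x ∈ Icc (0 : ℝ) 1) : derivWithin g (Icc 0 1) x
      = derivWithin g (Icc 0 1) 0 * Real.exp (∫ y in 0..x, intervalLogDeriv g y) := by
  have hg' : ContDiffOn ℝ 1 (derivWithin g (Icc 0 1)) (Icc 0 1) :=
    (contDiffOn_derivWithin (k := k + 1) hg).of_le (by norm_num)
  have hlog := eq_add_integral_derivWithin (hg'.log fun x hx => (hg.deriv_pos x hx).ne') hx
  have hcongr : ∫ y in 0..x, derivWithin (fun x => Real.log (derivWithin g (Icc 0 1) x)) (Icc 0 1) y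
      = ∫ y in 0..x, intervalLogDeriv g y := by
    refine intervalIntegral.integral_congr fun y hy => ?_
    rw [uIcc_of_le hx.1] at hy
    have hy' : y ∈ Icc (0 : ℝ) 1 := ⟨hy.1, hy.2.trans hx.2⟩
    rw [derivWithin.log (hg'.differentiableOn one_ne_zero y hy') (hg.deriv_pos y hy').ne'
      (uniqueDiffOn_Icc zero_lt_one y hy'), intervalLogDeriv, iteratedDerivWithin_succ',
      iteratedDerivWithin_one]
  rw [hcongr] at hlog
  rw [← Real.exp_log (hg.deriv_pos x hx), hlog, Real.exp_add,
    Real.exp_log (hg.deriv_pos 0 (by simp))]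

theorem derivWithin_eq_normalized_exp (hg : IsIntervalDiff (k + 2) g) {x : ℝ}
    (hx : x ∈ Icc (0 : ℝ) 1) : derivWithin g (Icc 0 1) x
      = (∫ z in 0..1, Real.exp (∫ y in 0..z, intervalLogDeriv g y))⁻¹
        * Real.exp (∫ y in 0..x, intervalLogDeriv g y) := by
  have htotal := eq_add_integral_derivWithin
    (hg.contDiffOn.of_le (by exact_mod_cast Nat.le_add_left 1 (k + 1))) (x := 1) (by simp)
  have hcongr : ∫ y in 0..1, derivWithin g (Icc 0 1) y = derivWithin g (Icc 0 1) 0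
      * ∫ x in 0..1, Real.exp (∫ y in 0..x, intervalLogDeriv g y) := by
    rw [← intervalIntegral.integral_const_mul]
    refine intervalIntegral.integral_congr fun y hy => ?_
    rw [uIcc_of_le zero_le_one] at hy
    exact hg.derivWithin_eq_mul_exp hy
  rw [hg.map_one, hg.map_zero, zero_add, hcongr] at htotal
  rw [hg.derivWithin_eq_mul_exp hx, eq_inv_of_mul_eq_one_left htotal.symm]

theorem integral_intervalLogDeriv (hg : IsIntervalDiff (k + 2) g)
    (h01 : derivWithin g (Icc 0 1) 0 = derivWithin g (Icc 0 1) 1) :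
    ∫ y in 0..1, intervalLogDeriv g y = 0 := by
  have hone := hg.derivWithin_eq_mul_exp (x := 1) (by simp)
  rw [← h01] at hone
  exact (Real.exp_eq_one_iff _).1
    (mul_left_cancel₀ (hg.deriv_pos 0 (by simp)).ne' (by rw [mul_one, ← hone]))

end IsIntervalDiff

theorem IsCircleLift.derivWithin_eq_deriv {k : ℕ} {F g : ℝ → ℝ} (hF : IsCircleLift k F)
    (hFg : EqOn F g (Icc 0 1)) {x : ℝ} (hx : x ∈ Icc (0 : ℝ) 1) :
    derivWithin g (Icc 0 1) x = deriv F x :=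
  ((hF.hasDerivAt x).hasDerivWithinAt.congr (fun _ hy => (hFg hy).symm)
    (hFg hx).symm).derivWithin (uniqueDiffOn_Icc zero_lt_one x hx)

theorem IsCircleLift.derivWithin_zero_eq_one {k : ℕ} {F g : ℝ → ℝ} (hF : IsCircleLift k F)
    (hFg : EqOn F g (Icc 0 1)) : derivWithin g (Icc 0 1) 0 = derivWithin g (Icc 0 1) 1 := by
  rw [hF.derivWithin_eq_deriv hFg (by simp), hF.derivWithin_eq_deriv hFg (by simp)]
  simpa using (hF.periodic_deriv 0).symm

/-! ### Smoothing the kink at the endpoints -/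

theorem abs_sub_le_of_exp_mul_le {x y η : ℝ} (hy : 0 ≤ y) (hlower : Real.exp (-η) * y ≤ x)
    (hupper : x ≤ Real.exp η * y) : |x - y| ≤ y * (Real.exp η - 1) := by
  have hcosh : 2 ≤ Real.exp η + Real.exp (-η) := by
    have := Real.one_le_cosh η
    rw [Real.cosh_eq] at this
    linarith
  rw [abs_le]
  constructor <;> nlinarith

theorem normalized_exp_le {L₁ L₂ : ℝ → ℝ} {η : ℝ} (hL₁ : ContinuousOn L₁ (Icc 0 1))
    (hL₂ : ContinuousOn L₂ (Icc 0 1)) (h : ∀ x ∈ Icc (0 : ℝ) 1, |L₁ x - L₂ x| ≤ η) {x : ℝ}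
    (hx : x ∈ Icc (0 : ℝ) 1) :
    (∫ y in 0..1, Real.exp (L₁ y))⁻¹ * Real.exp (L₁ x)
      ≤ Real.exp (2 * η) * ((∫ y in 0..1, Real.exp (L₂ y))⁻¹ * Real.exp (L₂ x)) := by
  have hintegral : ∫ y in 0..1, Real.exp (L₂ y) ≤ Real.exp η * ∫ y in 0..1, Real.exp (L₁ y) := by
    rw [← intervalIntegral.integral_const_mul]
    refine intervalIntegral.integral_mono_on zero_le_one
      (hL₂.rexp.intervalIntegrable_of_Icc zero_le_one)
      ((hL₁.rexp.intervalIntegrable_of_Icc zero_le_one).const_mul _) fun y hy => ?_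
    rw [← Real.exp_add]
    exact Real.exp_le_exp.2 (by linarith [(abs_le.1 (h y hy)).1])
  have hinv : (∫ y in 0..1, Real.exp (L₁ y))⁻¹
      ≤ Real.exp η * (∫ y in 0..1, Real.exp (L₂ y))⁻¹ := by
    rw [← div_eq_mul_inv, inv_eq_one_div,
      div_le_div_iff₀ (integral_exp_pos hL₁) (integral_exp_pos hL₂), one_mul]
    exact hintegral
  have hexp : Real.exp (L₁ x) ≤ Real.exp η * Real.exp (L₂ x) := by
    rw [← Real.exp_add]
    exact Real.exp_le_exp.2 (by linarith [(abs_le.1 (h x hx)).2])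
  calc _ ≤ (Real.exp η * (∫ y in 0..1, Real.exp (L₂ y))⁻¹) * (Real.exp η * Real.exp (L₂ x)) :=
        mul_le_mul hinv hexp (Real.exp_pos _).le
          (mul_nonneg (Real.exp_pos _).le (inv_nonneg.2 (integral_exp_pos hL₂).le))
    _ = _ := by rw [two_mul, Real.exp_add]; ring

/-- The lift of a `C³` circle diffeomorphism that approximates the diffeomorphism `g` of `[0, 1]`
with `g'(0) = g'(1)`, the kink of `g'` at the endpoints being spread over a `δ`-neighborhood. -/
noncomputable def smoothedLift (g : ℝ → ℝ) (δ : ℝ) : ℝ → ℝ :=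
  liftOfLogDeriv (smoothedDeriv (intervalLogDeriv g) δ)

/-- The part of `orbitalPotential a (smoothedLift g δ)` that stays bounded as `δ → 0`. -/
noncomputable def regularPotential (a : ℝ) (g : ℝ → ℝ) (δ x : ℝ) : ℝ :=
  endpointMatch (derivWithin (intervalLogDeriv g) (Icc 0 1)) δ x
    - 1 / 2 * meanZeroPrimitive (smoothedDeriv (intervalLogDeriv g) δ) x ^ 2
    + 2 * a * (deriv (smoothedLift g δ) x ^ 2 - 1)

section SmoothedLift

variable {g F : ℝ → ℝ} {δ : ℝ}

theorem isCircleLift_smoothedLift (hg : IsIntervalDiff 3 g) (hδ : 0 < δ) (hδ1 : δ ≤ 1) :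
    IsCircleLift 3 (smoothedLift g δ) :=
  have hw := hg.contDiffOn_intervalLogDeriv (k := 1)
  isCircleLift_liftOfLogDeriv (continuous_smoothedDeriv hw hδ hδ1) (periodic_smoothedDeriv _ δ)
    (integral_smoothedDeriv hw hδ hδ1)

theorem orbitalPotential_smoothedLift (a : ℝ) (hg : IsIntervalDiff 3 g) (hδ : 0 < δ)
    (hδ1 : δ ≤ 1) (x : ℝ) : orbitalPotential a (smoothedLift g δ) x
      = regularPotential a g δ x + endpointJump g * bump δ x := by
  rw [orbitalPotential, smoothedLift, schwarzianWithin_liftOfLogDeriv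
    (continuous_smoothedDeriv hg.contDiffOn_intervalLogDeriv hδ hδ1), regularPotential,
    smoothedDeriv, endpointJump, smoothedLift]
  ring

theorem continuous_regularPotential (a : ℝ) (hg : IsIntervalDiff 3 g) (hδ : 0 < δ)
    (hδ1 : δ ≤ 1) : Continuous (regularPotential a g δ) :=
  (((isCircleLift_smoothedLift hg hδ hδ1).continuous_orbitalPotential a).sub
    (continuous_const.mul (continuous_bump δ))).congr fun x =>
      sub_eq_of_eq_add (orbitalPotential_smoothedLift a hg hδ hδ1 x)

theorem deriv_smoothedLift_mem_Icc (hg : IsIntervalDiff 3 g) (hF : IsCircleLift 1 F)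
    (hFg : EqOn F g (Icc 0 1)) (hδ : 0 < δ) (hδ1 : δ ≤ 1) (x : ℝ) :
    deriv (smoothedLift g δ) x ∈
      Icc (Real.exp (-(2 * (3 * (endpointGap (intervalLogDeriv g) * δ)))) * deriv F x)
        (Real.exp (2 * (3 * (endpointGap (intervalLogDeriv g) * δ))) * deriv F x) := by
  have h01 := hF.derivWithin_zero_eq_one hFg
  have hw := hg.contDiffOn_intervalLogDeriv
  have hv := continuous_smoothedDeriv hw hδ hδ1
  have hL₁ := (contDiff_logDerivPrimitive hv).continuous.continuousOn (s := Icc (0 : ℝ) 1)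
  have hL₂ : ContinuousOn (fun x => ∫ y in 0..x, intervalLogDeriv g y) (Icc 0 1) := by
    simpa only [uIcc_of_le (zero_le_one' ℝ)] using
      intervalIntegral.continuousOn_primitive_interval (μ := volume) (a := 0) (b := 1)
        (by rw [uIcc_of_le (zero_le_one' ℝ)]; exact hw.continuousOn.integrableOn_Icc)
  have hclose (y : ℝ) (hy : y ∈ Icc (0 : ℝ) 1) :=
    abs_logDerivPrimitive_smoothedDeriv_sub_le hw (hg.integral_intervalLogDeriv h01) hδ hδ1 hy
  have hx := fract_mem_Icc x
  rw [← periodic_apply_fract hF.periodic_deriv x,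
    ← periodic_apply_fract (isCircleLift_smoothedLift hg hδ hδ1).periodic_deriv x,
    ← hF.derivWithin_eq_deriv hFg hx, hg.derivWithin_eq_normalized_exp hx, smoothedLift,
    deriv_liftOfLogDeriv hv, Real.exp_neg, mem_Icc, inv_mul_le_iff₀ (Real.exp_pos _)]
  exact ⟨normalized_exp_le hL₂ hL₁ (fun y hy => (abs_sub_comm _ _).trans_le (hclose y hy)) hx,
    normalized_exp_le hL₁ hL₂ hclose hx⟩

theorem IsCircleLift.exists_deriv_le (hF : IsCircleLift 1 F) : ∃ D, ∀ x, deriv F x ≤ D := by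
  obtain ⟨D, hD⟩ := isCompact_Icc.bddAbove_image
    ((hF.continuous_deriv le_rfl).continuousOn (s := Icc (0 : ℝ) 1))
  refine ⟨D, fun x => ?_⟩
  rw [← periodic_apply_fract hF.periodic_deriv x]
  exact hD (mem_image_of_mem _ (fract_mem_Icc x))

theorem tendstoUniformly_deriv_smoothedLift (hg : IsIntervalDiff 3 g) (hF : IsCircleLift 1 F)
    (hFg : EqOn F g (Icc 0 1)) :
    TendstoUniformly (fun δ => deriv (smoothedLift g δ)) (deriv F) (𝓝[>] 0) := by
  obtain ⟨D, hD⟩ := hF.exists_deriv_le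
  set η : ℝ → ℝ := fun δ => 2 * (3 * (endpointGap (intervalLogDeriv g) * δ))
  have hbound : Tendsto (fun δ => D * (Real.exp (η δ) - 1)) (𝓝[>] 0) (𝓝 0) :=
    tendsto_nhdsWithin_of_tendsto_nhds (Continuous.tendsto' (by fun_prop) _ _ (by simp [η]))
  rw [Metric.tendstoUniformly_iff]
  intro ε hε
  filter_upwards [hbound.eventually (gt_mem_nhds hε), Ioc_mem_nhdsGT one_pos]
    with δ hδε hδ x
  have hcompare := deriv_smoothedLift_mem_Icc hg hF hFg hδ.1 hδ.2 x
  have hη : 0 ≤ η δ := by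
    have := endpointGap_nonneg (intervalLogDeriv g)
    have := hδ.1
    positivity
  rw [dist_comm, Real.dist_eq]
  calc _ ≤ deriv F x * (Real.exp (η δ) - 1) :=
        abs_sub_le_of_exp_mul_le (hF.deriv_pos x).le hcompare.1 hcompare.2
    _ ≤ D * (Real.exp (η δ) - 1) :=
        mul_le_mul_of_nonneg_right (hD x) (by linarith [Real.one_le_exp hη])
    _ < ε := hδε

theorem deriv_smoothedLift_le (hg : IsIntervalDiff 3 g) (hF : IsCircleLift 1 F)
    (hFg : EqOn F g (Icc 0 1)) (hδ : 0 < δ) (hδ1 : δ ≤ 1) (x : ℝ) :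
    deriv (smoothedLift g δ) x ≤ Real.exp (6 * endpointGap (intervalLogDeriv g)) * deriv F x := by
  refine (deriv_smoothedLift_mem_Icc hg hF hFg hδ hδ1 x).2.trans
    (mul_le_mul_of_nonneg_right (Real.exp_le_exp.2 ?_) (hF.deriv_pos x).le)
  nlinarith [endpointGap_nonneg (intervalLogDeriv g)]

theorem exists_abs_regularPotential_le (a : ℝ) (hg : IsIntervalDiff 3 g) (hF : IsCircleLift 1 F)
    (hFg : EqOn F g (Icc 0 1)) :
    ∃ C, ∀ δ ∈ Ioc (0 : ℝ) 1, ∀ x, |regularPotential a g δ x| ≤ C := by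
  have h01 := hF.derivWithin_zero_eq_one hFg
  have hw := hg.contDiffOn_intervalLogDeriv (k := 1)
  obtain ⟨M, hM⟩ := isCompact_Icc.exists_bound_of_continuousOn
    (hw.continuousOn_derivWithin (uniqueDiffOn_Icc zero_lt_one) le_rfl)
  obtain ⟨N, hN⟩ := isCompact_Icc.exists_bound_of_continuousOn hw.continuousOn
  obtain ⟨D, hD⟩ := hF.exists_deriv_le
  set K := endpointGap (intervalLogDeriv g)
  refine ⟨2 * M + 1 / 2 * (N + 4 * K) ^ 2 + |2 * a| * ((Real.exp (6 * K) * D) ^ 2 + 1),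
    fun δ hδ x => ?_⟩
  have hmean : |meanZeroPrimitive (smoothedDeriv (intervalLogDeriv g) δ) x| ≤ N + 4 * K :=
    abs_meanZeroPrimitive_smoothedDeriv_le hw (hg.integral_intervalLogDeriv h01) hδ.1 hδ.2 hN x
  have hderiv_pos := (isCircleLift_smoothedLift hg hδ.1 hδ.2).deriv_pos x
  have hderiv : deriv (smoothedLift g δ) x ≤ Real.exp (6 * K) * D :=
    (deriv_smoothedLift_le hg hF hFg hδ.1 hδ.2 x).trans
      (mul_le_mul_of_nonneg_left (hD x) (Real.exp_pos _).le)
  refine (abs_add_le _ _).trans (add_le_add ((abs_sub _ _).trans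
    (add_le_add (abs_endpointMatch_le hδ.1 hM x) ?_)) ?_)
  · rw [abs_mul, abs_of_pos one_half_pos, abs_pow]
    gcongr
  · rw [abs_mul]
    gcongr
    refine (abs_sub _ _).trans ?_
    rw [abs_one, abs_pow, abs_of_pos hderiv_pos]
    gcongr

theorem eventually_fract_mem_Icc {x : ℝ} (hx : 0 < Int.fract x) :
    ∀ᶠ p : ℝ × ℝ in 𝓝[>] 0 ×ˢ 𝓝 x, Int.fract p.2 ∈ Icc p.1 (1 - p.1) := by
  have hδ : Tendsto (fun p : ℝ × ℝ => p.1) (𝓝[>] 0 ×ˢ 𝓝 x) (𝓝 0) :=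
    tendsto_fst.mono_right nhdsWithin_le_nhds
  have hfract : Tendsto (fun p : ℝ × ℝ => Int.fract p.2) (𝓝[>] 0 ×ˢ 𝓝 x) (𝓝 (Int.fract x)) :=
    (continuousAt_fract (Int.fract_pos.1 hx)).tendsto.comp tendsto_snd
  filter_upwards [hδ.eventually_lt hfract hx,
    (hfract.add hδ).eventually_lt_const (by simpa using Int.fract_lt_one x)] with p hp0 hp1
  exact ⟨hp0.le, by linarith⟩

theorem tendsto_meanZeroPrimitive_smoothedDeriv {w : ℝ → ℝ} (hw : ContDiffOn ℝ 1 w (Icc 0 1))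
    (hw0 : ∫ y in 0..1, w y = 0) {x : ℝ} (hx : 0 < Int.fract x) :
    Tendsto (fun p : ℝ × ℝ => meanZeroPrimitive (smoothedDeriv w p.1) p.2) (𝓝[>] 0 ×ˢ 𝓝 x)
      (𝓝 (w (Int.fract x))) := by
  have hw_tendsto : Tendsto (fun p : ℝ × ℝ => w (Int.fract p.2)) (𝓝[>] 0 ×ˢ 𝓝 x)
      (𝓝 (w (Int.fract x))) :=
    (hw.continuousOn.continuousAt (Icc_mem_nhds hx (Int.fract_lt_one x))).tendsto.comp
      ((continuousAt_fract (Int.fract_pos.1 hx)).tendsto.comp tendsto_snd)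
  have hbound : Tendsto (fun p : ℝ × ℝ => endpointGap w * p.1 * 2) (𝓝[>] 0 ×ˢ 𝓝 x) (𝓝 0) :=
    (tendsto_nhdsWithin_of_tendsto_nhds
      (Continuous.tendsto' (by fun_prop) _ _ (by simp) : Tendsto (fun δ => endpointGap w * δ * 2)
        (𝓝 0) (𝓝 0))).comp tendsto_fst
  refine tendsto_of_tendsto_of_dist hw_tendsto (squeeze_zero' (Eventually.of_forall
    fun _ => dist_nonneg) ?_ hbound)
  filter_upwards [eventually_fract_mem_Icc hx, tendsto_fst.eventually (Ioc_mem_nhdsGT one_pos)]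
    with p hp hδ
  rw [dist_comm, Real.dist_eq,
    ← periodic_apply_fract (periodic_meanZeroPrimitive_smoothedDeriv hw hδ.1 hδ.2)]
  have hle := abs_meanZeroPrimitive_smoothedDeriv_sub_le hw hw0 hδ.1 hδ.2 (fract_mem_Icc p.2)
  rwa [bump_eq_zero hδ.1 (by rwa [Int.fract_fract]), add_zero] at hle

theorem tendsto_regularPotential (a : ℝ) (hg : IsIntervalDiff 3 g) (hF : IsCircleLift 1 F)
    (hFg : EqOn F g (Icc 0 1)) {x : ℝ} (hx : 0 < Int.fract x) :
    Tendsto (fun p : ℝ × ℝ => regularPotential a g p.1 p.2) (𝓝[>] 0 ×ˢ 𝓝 x)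
      (𝓝 (pinnedPotential a g x)) := by
  have hw := hg.contDiffOn_intervalLogDeriv (k := 1)
  have hw₁ := hw.continuousOn_derivWithin (uniqueDiffOn_Icc zero_lt_one) le_rfl
  have hmatch : Tendsto (fun p : ℝ × ℝ =>
      endpointMatch (derivWithin (intervalLogDeriv g) (Icc 0 1)) p.1 p.2) (𝓝[>] 0 ×ˢ 𝓝 x)
      (𝓝 (derivWithin (intervalLogDeriv g) (Icc 0 1) (Int.fract x))) := by
    refine ((hw₁.continuousAt (Icc_mem_nhds hx (Int.fract_lt_one x))).tendsto.comp
      ((continuousAt_fract (Int.fract_pos.1 hx)).tendsto.comp tendsto_snd)).congr' ?_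
    filter_upwards [eventually_fract_mem_Icc hx, tendsto_fst.eventually self_mem_nhdsWithin]
      with p hp hδ
    exact (endpointMatch_eq hδ hp).symm
  have hmean := tendsto_meanZeroPrimitive_smoothedDeriv hw
    (hg.integral_intervalLogDeriv (hF.derivWithin_zero_eq_one hFg)) hx
  have hderiv : Tendsto (fun p : ℝ × ℝ => deriv (smoothedLift g p.1) p.2) (𝓝[>] 0 ×ˢ 𝓝 x)
      (𝓝 (derivWithin g (Icc 0 1) (Int.fract x))) := by
    rw [hF.derivWithin_eq_deriv hFg (fract_mem_Icc x), periodic_apply_fract hF.periodic_deriv]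
    have huniform : TendstoUniformly (fun p : ℝ × ℝ => deriv (smoothedLift g p.1)) (deriv F)
        (𝓝[>] 0 ×ˢ 𝓝 x) := fun u hu =>
      tendsto_fst.eventually (tendstoUniformly_deriv_smoothedLift hg hF hFg u hu)
    exact huniform.tendsto_comp (hF.continuous_deriv le_rfl).continuousAt tendsto_snd
  exact (hmatch.sub ((hmean.pow 2).const_mul _)).add (((hderiv.pow 2).sub_const 1).const_mul _)

end SmoothedLift

/-! ### Convergence in `Diff¹(𝕋)` and of the densities -/

theorem abs_sub_le_of_abs_deriv_sub_le {f g : ℝ → ℝ} (hf : Differentiable ℝ f)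
    (hg : Differentiable ℝ g) (h0 : f 0 = g 0) {ε : ℝ} (h : ∀ x, |deriv f x - deriv g x| ≤ ε)
    {x : ℝ} (hx : x ∈ Icc (0 : ℝ) 1) : |f x - g x| ≤ ε := by
  have hmean := norm_image_sub_le_of_norm_deriv_le_segment' (f := fun x => f x - g x)
    (f' := fun x => deriv f x - deriv g x) (a := 0) (b := x) (C := ε)
    (fun y _ => ((hf y).hasDerivAt.sub (hg y).hasDerivAt).hasDerivWithinAt) (fun y _ => h y) x
    ⟨hx.1, le_rfl⟩
  simp only [h0, sub_self, sub_zero, Real.norm_eq_abs] at hmean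
  exact hmean.trans (mul_le_of_le_one_right ((abs_nonneg _).trans (h 0)) hx.2)

theorem CircleDiff.tendsto_of_tendstoUniformly_deriv {ι : Type*} {l : Filter ι}
    {ψ : ι → CircleDiff 1} {f : CircleDiff 1} {Fs : ι → ℝ → ℝ} {F : ℝ → ℝ}
    (hFs : ∀ i, IsCircleLift 1 (Fs i)) (hψ : ∀ i (x : ℝ), ψ i (x : Circ) = (Fs i x : Circ))
    (hF : IsCircleLift 1 F) (hf : ∀ x : ℝ, f (x : Circ) = (F x : Circ))
    (h0 : ∀ i, Fs i 0 = F 0)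
    (h : TendstoUniformly (fun i => _root_.deriv (Fs i)) (_root_.deriv F) l) :
    Tendsto ψ l (𝓝 f) := by
  rw [isInducing_toC1.tendsto_nhds_iff, nhds_prod_eq]
  refine Tendsto.prodMk ?_ ?_ <;>
    rw [ContinuousMap.tendsto_iff_tendstoUniformly, Metric.tendstoUniformly_iff] <;>
    intro ε hε
  · filter_upwards [Metric.tendstoUniformly_iff.1 h (ε / 2) (half_pos hε)] with i hi t
    have hclose := abs_sub_le_of_abs_deriv_sub_le hF.differentiable (hFs i).differentiable
      (h0 i).symm (fun x => (hi x).le) (fract_mem_Icc (circRep t))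
    change dist (f t) (ψ i t) < ε
    rw [← coe_circRep t, ← coe_circRep (circRep t), circRep_coe, hf, hψ, dist_eq_norm,
      ← AddCircle.coe_sub]
    exact (QuotientAddGroup.norm_mk_le_norm.trans hclose).trans_lt (half_lt_self hε)
  · filter_upwards [Metric.tendstoUniformly_iff.1 h ε hε] with i hi t
    obtain ⟨x, rfl⟩ := exists_coe_circ t
    change dist (f.deriv x) ((ψ i).deriv x) < ε
    rw [deriv_coe hF.continuous hf, deriv_coe (hFs i).continuous (hψ i)]
    exact hi x

theorem exists_abs_sub_intCast_lt_of_bump_ne_zero {δ x : ℝ} (hδ : 0 < δ) (h : bump δ x ≠ 0) :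
    ∃ n : ℤ, |x - n| < δ := by
  by_contra! hfar
  refine h (bump_eq_zero hδ ⟨?_, ?_⟩)
  · simpa only [Int.self_sub_floor, Int.abs_fract] using hfar ⌊x⌋
  · have hnext := hfar (⌊x⌋ + 1)
    rw [Int.cast_add, Int.cast_one, ← sub_sub, Int.self_sub_floor,
      abs_of_nonpos (by linarith [Int.fract_lt_one x])] at hnext
    linarith

namespace IsCircleLift

variable {G w : ℝ → ℝ}

theorem integral_bump_mul_deriv (hG : IsCircleLift 1 G) {δ : ℝ} (hδ : 0 < δ)
    (hδ1 : δ ≤ 1) (θ t : ℝ) : ∫ τ in t..t + 1, bump δ (G τ + θ) * deriv G τ = 1 := by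
  have hsubst := intervalIntegral.integral_comp_mul_deriv (a := t) (b := t + 1)
    (fun x _ => (hG.hasDerivAt x).add_const θ) (hG.continuous_deriv le_rfl).continuousOn
    (continuous_bump δ)
  simp only [Function.comp_apply] at hsubst
  rw [hsubst, hG.add_one, add_right_comm, (periodic_bump δ).intervalIntegral_add_eq (G t + θ) 0,
    zero_add, integral_bump hδ hδ1]

theorem integral_bump_mul_deriv_mul_mem (hG : IsCircleLift 1 G) {δ : ℝ} (hδ : 0 < δ)
    (hδ1 : δ ≤ 1) (θ t : ℝ) {m M : ℝ} {k : ℝ → ℝ} (hk : Continuous k)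
    (h : ∀ τ, bump δ (G τ + θ) ≠ 0 → k τ ∈ Icc m M) :
    ∫ τ in t..t + 1, bump δ (G τ + θ) * deriv G τ * k τ ∈ Icc m M := by
  have hGc := hG.continuous
  have hG' := hG.continuous_deriv le_rfl
  have hnonneg (τ : ℝ) : 0 ≤ bump δ (G τ + θ) * deriv G τ :=
    mul_nonneg (bump_nonneg hδ _) (hG.deriv_pos τ).le
  have hpointwise (τ : ℝ) : bump δ (G τ + θ) * deriv G τ * m ≤ bump δ (G τ + θ) * deriv G τ * k τ
      ∧ bump δ (G τ + θ) * deriv G τ * k τ ≤ bump δ (G τ + θ) * deriv G τ * M := by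
    by_cases hτ : bump δ (G τ + θ) = 0
    · simp [hτ]
    · exact ⟨mul_le_mul_of_nonneg_left (h τ hτ).1 (hnonneg τ),
        mul_le_mul_of_nonneg_left (h τ hτ).2 (hnonneg τ)⟩
  have hconst (c : ℝ) : ∫ τ in t..t + 1, bump δ (G τ + θ) * deriv G τ * c = c := by
    rw [intervalIntegral.integral_mul_const, hG.integral_bump_mul_deriv hδ hδ1, one_mul]
  constructor
  · rw [← hconst m]
    exact intervalIntegral.integral_mono (by linarith)
      (Continuous.intervalIntegrable (by fun_prop) _ _)
      (Continuous.intervalIntegrable (by fun_prop) _ _) fun τ => (hpointwise τ).1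
  · rw [← hconst M]
    exact intervalIntegral.integral_mono (by linarith)
      (Continuous.intervalIntegrable (by fun_prop) _ _)
      (Continuous.intervalIntegrable (by fun_prop) _ _) fun τ => (hpointwise τ).2

theorem tendsto_integral_bump_mul_deriv_mul (hG : IsCircleLift 1 G) (hw : Continuous w)
    (hw1 : Function.Periodic w 1) (t : ℝ) :
    Tendsto (fun p : ℝ × ℝ => ∫ τ in t..t + 1, bump p.1 (G τ + p.2) * deriv G τ * w (G τ))
      (𝓝[>] 0 ×ˢ 𝓝 0) (𝓝 (w 0)) := by
  rw [Metric.nhds_basis_closedBall.tendsto_right_iff]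
  intro ε hε
  obtain ⟨ρ, hρ, hwρ⟩ := Metric.continuousAt_iff.1 (hw.continuousAt (x := 0)) ε hε
  have hsmall : Tendsto (fun p : ℝ × ℝ => p.1 + |p.2|) (𝓝[>] 0 ×ˢ 𝓝 0) (𝓝 (0 + |0|)) :=
    (tendsto_fst.mono_right nhdsWithin_le_nhds).add tendsto_snd.abs
  filter_upwards [tendsto_fst.eventually (Ioc_mem_nhdsGT one_pos),
    hsmall.eventually_lt_const (by simpa using hρ)] with p hδ hp
  rw [Real.closedBall_eq_Icc]
  refine hG.integral_bump_mul_deriv_mul_mem hδ.1 hδ.2 p.2 t (hw.comp hG.continuous) fun τ hτ => ?_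
  obtain ⟨n, hn⟩ := exists_abs_sub_intCast_lt_of_bump_ne_zero hδ.1 hτ
  rw [← hw1.sub_int_mul_eq (x := G τ) n, mul_one, ← Real.closedBall_eq_Icc]
  refine (hwρ ?_).le
  rw [dist_zero_right, Real.norm_eq_abs]
  calc |G τ - n| = |(G τ + p.2 - n) - p.2| := by ring_nf
    _ ≤ |G τ + p.2 - n| + |p.2| := abs_sub _ _
    _ < ρ := by linarith

theorem tendsto_integral_bump_mul_deriv_sq (hG : IsCircleLift 1 G) {t₀ : ℝ}
    (h0 : (G t₀ : Circ) = 0) (t : ℝ) :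
    Tendsto (fun p : ℝ × ℝ => ∫ τ in t..t + 1, bump p.1 (G τ + p.2) * deriv G τ ^ 2)
      (𝓝[>] 0 ×ˢ 𝓝 0) (𝓝 (deriv G t₀)) := by
  obtain ⟨n, hn⟩ := coe_circ_eq_iff.1 (h0 : (G t₀ : Circ) = ((0 : ℝ) : Circ))
  have hw1 : Function.Periodic (fun y => deriv G (hG.symm y)) 1 := fun y => by
    simp only [hG.isCircleLift_symm.add_one, hG.periodic_deriv _]
  have hw0 : deriv G (hG.symm 0) = deriv G t₀ := by
    simpa [← hn, hG.symm_apply] using (hw1.int_mul n 0).symm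
  have hlim := hG.tendsto_integral_bump_mul_deriv_mul
    ((hG.continuous_deriv le_rfl).comp hG.symm.continuous) hw1 t
  simpa only [Function.comp_apply, hG.symm_apply, mul_assoc, ← pow_two, hw0] using hlim

theorem ae_fract_pos (hG : IsCircleLift 1 G) : ∀ᵐ τ : ℝ, 0 < Int.fract (G τ) := by
  filter_upwards [((countable_range ((↑) : ℤ → ℝ)).preimage hG.strictMono.injective).ae_notMem
    volume] with τ hτ
  exact Int.fract_pos.2 fun h => hτ ⟨_, h.symm⟩

theorem tendsto_integral_regularPotential (hG : IsCircleLift 1 G) {g F : ℝ → ℝ} (a : ℝ)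
    (hg : IsIntervalDiff 3 g) (hF : IsCircleLift 1 F) (hFg : EqOn F g (Icc 0 1)) (t : ℝ) :
    Tendsto (fun p : ℝ × ℝ => ∫ τ in t..t + 1, regularPotential a g p.1 (G τ + p.2) * deriv G τ ^ 2)
      (𝓝[>] 0 ×ˢ 𝓝 0) (𝓝 (∫ τ in t..t + 1, pinnedPotential a g (G τ) * deriv G τ ^ 2)) := by
  obtain ⟨C, hC⟩ := exists_abs_regularPotential_le a hg hF hFg
  have hGc := hG.continuous
  have hG' := hG.continuous_deriv le_rfl
  have hδ : ∀ᶠ p : ℝ × ℝ in 𝓝[>] 0 ×ˢ 𝓝 0, p.1 ∈ Ioc 0 1 :=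
    tendsto_fst.eventually (Ioc_mem_nhdsGT one_pos)
  refine intervalIntegral.tendsto_integral_filter_of_dominated_convergence
    (fun τ => C * deriv G τ ^ 2) ?_ ?_ (Continuous.intervalIntegrable (by fun_prop) _ _) ?_
  · filter_upwards [hδ] with p hp
    have := continuous_regularPotential a hg hp.1 hp.2
    exact Continuous.aestronglyMeasurable (by fun_prop)
  · filter_upwards [hδ] with p hp
    refine Eventually.of_forall fun τ _ => ?_
    rw [norm_mul, Real.norm_eq_abs, Real.norm_eq_abs, abs_of_nonneg (sq_nonneg (deriv G τ))]
    exact mul_le_mul_of_nonneg_right (hC _ hp _) (sq_nonneg _)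
  · filter_upwards [hG.ae_fract_pos] with τ hτ _
    have hshift : Tendsto (fun p : ℝ × ℝ => (p.1, G τ + p.2)) (𝓝[>] 0 ×ˢ 𝓝 0)
        (𝓝[>] 0 ×ˢ 𝓝 (G τ)) :=
      tendsto_fst.prodMk
        (((continuous_const_add (G τ)).tendsto' 0 _ (add_zero _)).comp tendsto_snd)
    exact ((tendsto_regularPotential a hg hF hFg hτ).comp hshift).mul_const _

end IsCircleLift

section Densities

variable {g F : ℝ → ℝ} (σ a : ℝ) {ψ : CircleDiff 3} {φ : CircleDiff 1} {δ : ℝ}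

theorem orbitalDensity_smoothedLift_rot_mul (hg : IsIntervalDiff 3 g) (hδ : 0 < δ) (hδ1 : δ ≤ 1)
    (hψ : ∀ x : ℝ, ψ (x : Circ) = (smoothedLift g δ x : Circ)) {G : ℝ → ℝ} (hG : IsCircleLift 1 G)
    (hφ : ∀ x : ℝ, φ (x : Circ) = (G x : Circ)) (θ t : ℝ) :
    orbitalDensity σ a ψ (rot θ * φ) = Real.exp (1 / σ ^ 2 *
      (endpointJump g * (∫ τ in t..t + 1, bump δ (G τ + θ) * deriv G τ ^ 2)
        + ∫ τ in t..t + 1, regularPotential a g δ (G τ + θ) * deriv G τ ^ 2)) := by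
  have hGc := hG.continuous
  have hG' := hG.continuous_deriv le_rfl
  have hreg := continuous_regularPotential a hg hδ hδ1
  rw [orbitalDensity_rot_mul σ a (isCircleLift_smoothedLift hg hδ hδ1) hψ hGc hφ t,
    ← intervalIntegral.integral_const_mul (endpointJump g), ← intervalIntegral.integral_add
    (Continuous.intervalIntegrable (by fun_prop) _ _)
    (Continuous.intervalIntegrable (by fun_prop) _ _)]
  simp only [orbitalPotential_smoothedLift a hg hδ hδ1, add_mul, mul_assoc, add_comm]

theorem orbitalDensity_smoothedLift_rot_mul_le {C R : ℝ} (hg : IsIntervalDiff 3 g) (hδ : 0 < δ)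
    (hδ1 : δ ≤ 1) (hC : ∀ x, |regularPotential a g δ x| ≤ C)
    (hψ : ∀ x : ℝ, ψ (x : Circ) = (smoothedLift g δ x : Circ)) (hR : ∀ t, φ.deriv t ≤ R) (θ : ℝ) :
    orbitalDensity σ a ψ (rot θ * φ)
      ≤ Real.exp (1 / σ ^ 2 * (|endpointJump g| * R + C * R ^ 2)) := by
  have hG := φ.isCircleLift_lift
  have hR' (τ : ℝ) : deriv φ.lift τ ≤ R := hR (τ : Circ)
  have hC0 : 0 ≤ C := (abs_nonneg _).trans (hC 0)
  have hbump : ∫ τ in (0 : ℝ)..0 + 1, bump δ (φ.lift τ + θ) * deriv φ.lift τ ^ 2 ∈ Icc 0 R := by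
    have := hG.integral_bump_mul_deriv_mul_mem hδ hδ1 θ 0 (hG.continuous_deriv le_rfl)
      fun τ _ => ⟨(hG.deriv_pos τ).le, hR' τ⟩
    simpa only [pow_two, mul_assoc] using this
  have hreg : |∫ τ in (0 : ℝ)..0 + 1, regularPotential a g δ (φ.lift τ + θ) * deriv φ.lift τ ^ 2|
      ≤ C * R ^ 2 := by
    rw [← Real.norm_eq_abs]
    refine (intervalIntegral.norm_integral_le_of_norm_le_const (C := C * R ^ 2)
      fun τ _ => ?_).trans_eq (by simp)
    rw [norm_mul, norm_pow, Real.norm_eq_abs, Real.norm_eq_abs, abs_of_pos (hG.deriv_pos τ)]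
    have := (hG.deriv_pos τ).le
    gcongr
    exacts [hC _, hR' τ]
  rw [orbitalDensity_smoothedLift_rot_mul σ a hg hδ hδ1 hψ hG φ.coe_lift θ 0]
  gcongr
  exacts [hbump.1, le_abs_self _, hbump.2, (le_abs_self _).trans hreg]

theorem tendsto_orbitalDensity_smoothedLift_rot_mul (hg : IsIntervalDiff 3 g)
    (hF : IsCircleLift 1 F) (hFg : EqOn F g (Icc 0 1)) {ι : Type*} {l : Filter ι}
    {ψ : ι → CircleDiff 3} {δ θ : ι → ℝ} (hδ0 : Tendsto δ l (𝓝 0)) (hδ : ∀ i, δ i ∈ Ioc 0 1)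
    (hψ : ∀ i (x : ℝ), ψ i (x : Circ) = (smoothedLift g (δ i) x : Circ))
    (hθ : Tendsto θ l (𝓝 0)) {t₀ : ℝ} (hφ : φ (t₀ : Circ) = 0) :
    Tendsto (fun i => orbitalDensity σ a (ψ i) (rot (θ i : Circ) * φ)) l
      (𝓝 (√(derivWithin g (Icc 0 1) 0 * derivWithin g (Icc 0 1) 1)
        * pinnedDensity σ a t₀ g φ)) := by
  have hG := φ.isCircleLift_lift
  have hsqrt : √(derivWithin g (Icc 0 1) 0 * derivWithin g (Icc 0 1) 1) ≠ 0 :=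
    (Real.sqrt_pos.2 (mul_pos (hg.deriv_pos 0 (by simp)) (hg.deriv_pos 1 (by simp)))).ne'
  have hp : Tendsto (fun i => (δ i, θ i)) l (𝓝[>] 0 ×ˢ 𝓝 0) :=
    (tendsto_nhdsWithin_iff.2 ⟨hδ0, Eventually.of_forall fun i => (hδ i).1⟩).prodMk hθ
  rw [pinnedDensity_eq σ a g hG.continuous φ.coe_lift t₀ 0, ← mul_assoc,
    mul_one_div_cancel hsqrt, one_mul]
  refine Tendsto.congr (fun i => (orbitalDensity_smoothedLift_rot_mul σ a hg (hδ i).1 (hδ i).2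
    (hψ i) hG φ.coe_lift (θ i) 0).symm) ?_
  have hbump := (hG.tendsto_integral_bump_mul_deriv_sq
    ((φ.coe_lift t₀).symm.trans hφ) 0).comp hp
  have hregular := (hG.tendsto_integral_regularPotential a hg hF hFg 0).comp hp
  simp only [Function.comp_def] at hbump hregular
  exact (Real.continuous_exp.tendsto _).comp (((hbump.const_mul _).add hregular).const_mul _)

end Densities

/-! ### Passing to the limit in changes of variables -/

section MeasureOfOpen

variable {X : Type*} [TopologicalSpace X] [MeasurableSpace X] [BorelSpace X]
  [HasOuterApproxClosed X] {μ ν : Measure X}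

theorem measure_open_le_of_forall_lintegral_le {O : Set X} (hO : IsOpen O)
    (h : ∀ H : X →ᵇ ℝ≥0, (∀ x ∉ O, H x = 0) → ∫⁻ x, H x ∂μ ≤ ∫⁻ x, H x ∂ν) : μ O ≤ ν O := by
  set H : ℕ → X →ᵇ ℝ≥0 := fun n => 1 - hO.isClosed_compl.apprSeq n
  have hzero (n : ℕ) (x : X) (hx : x ∉ O) : H n x = 0 := by
    simp [H, HasOuterApproxClosed.apprSeq_apply_eq_one hO.isClosed_compl n hx]
  have hle (n : ℕ) : ∫⁻ x, H n x ∂ν ≤ ν O := by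
    rw [← lintegral_indicator_one hO.measurableSet]
    refine lintegral_mono fun x => ?_
    by_cases hx : x ∈ O
    · simp [H, hx]
    · simp [hzero n x hx]
  have hlim (x : X) : Tendsto (fun n => (H n x : ℝ≥0∞)) atTop (𝓝 (O.indicator 1 x)) := by
    have happr := tendsto_pi_nhds.1
      (HasOuterApproxClosed.tendsto_apprSeq hO.isClosed_compl) x
    have hsub := ENNReal.tendsto_coe.2 (happr.const_sub 1)
    by_cases hx : x ∈ O <;> simpa [H, hx] using hsub
  calc μ O = ∫⁻ x, liminf (fun n => (H n x : ℝ≥0∞)) atTop ∂μ := by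
        simp only [(hlim _).liminf_eq, lintegral_indicator_one hO.measurableSet]
    _ ≤ liminf (fun n => ∫⁻ x, H n x ∂μ) atTop :=
        lintegral_liminf_le fun n => (H n).continuous.measurable.coe_nnreal_ennreal
    _ ≤ ν O := liminf_le_of_le (by isBoundedDefault) fun b hb =>
        (hb.exists.choose_spec.trans (h _ (hzero _))).trans (hle _)

theorem restrict_eq_of_forall_lintegral_eq {V : Set X} (hV : IsOpen V) (hμV : μ V ≠ ∞)
    (h : ∀ H : X →ᵇ ℝ≥0, (∀ x ∉ V, H x = 0) → ∫⁻ x, H x ∂μ = ∫⁻ x, H x ∂ν) :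
    μ.restrict V = ν.restrict V := by
  have hopen {O : Set X} (hO : IsOpen O) (hOV : O ⊆ V) : μ O = ν O :=
    (measure_open_le_of_forall_lintegral_le hO fun H hH =>
      (h H fun x hx => hH x (notMem_subset hOV hx)).le).antisymm
    (measure_open_le_of_forall_lintegral_le hO fun H hH =>
      (h H fun x hx => hH x (notMem_subset hOV hx)).ge)
  have := isFiniteMeasure_restrict.2 hμV
  refine ext_of_generate_finite _ BorelSpace.measurable_eq isPiSystem_isOpen (fun O hO => ?_) ?_
  · rw [Measure.restrict_apply hO.measurableSet, Measure.restrict_apply hO.measurableSet]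
    exact hopen (hO.inter hV) inter_subset_right
  · simpa only [Measure.restrict_apply_univ] using hopen hV Subset.rfl

theorem measure_ext_of_locally_forall_lintegral_eq [SecondCountableTopology X]
    (h : ∀ x, ∃ V, IsOpen V ∧ x ∈ V ∧ μ V ≠ ∞ ∧
      ∀ H : X →ᵇ ℝ≥0, (∀ y ∉ V, H y = 0) → ∫⁻ y, H y ∂μ = ∫⁻ y, H y ∂ν) : μ = ν := by
  choose V hV hxV hμV hH using h
  obtain ⟨s, hs, hcover⟩ := TopologicalSpace.countable_cover_nhds fun x => (hV x).mem_nhds (hxV x)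
  exact (Measure.ext_iff_of_biUnion_eq_univ hs hcover).2 fun x _ =>
    restrict_eq_of_forall_lintegral_eq (hV x) (hμV x) (hH x)

end MeasureOfOpen

section TopologicalGroup

variable {X : Type*} [Group X] [TopologicalSpace X]

theorem exists_nhds_forall_mul_mem_imp_mem [IsTopologicalGroup X] {f φ : X} {U : Set X}
    (hU : U ∈ 𝓝 (f⁻¹ * φ)) : ∃ W ∈ 𝓝 f, ∃ V, IsOpen V ∧ φ ∈ V ∧
      ∀ s ∈ W, ∀ x, s * x ∈ V → x ∈ U := by
  have hcont : Continuous fun p : X × X => p.1⁻¹ * p.2 := by fun_prop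
  obtain ⟨W, hW, V₁, hV₁, hWV⟩ := mem_nhds_prod_iff.1
    (hcont.continuousAt.preimage_mem_nhds (x := (f, φ)) hU)
  obtain ⟨V, hVV₁, hV, hφV⟩ := mem_nhds_iff.1 hV₁
  refine ⟨W, hW, V, hV, hφV, fun s hs x hx => ?_⟩
  simpa using hWV (mk_mem_prod hs (hVV₁ hx))

theorem tendsto_lintegral_mul_comp_mul [ContinuousMul X] [MeasurableSpace X] [BorelSpace X]
    {ν : Measure X} {ι : Type*} {l : Filter ι} [l.IsCountablyGenerated] {f : X} {s : ι → X}
    (hs : Tendsto s l (𝓝 f)) {U V : Set X} (hU : MeasurableSet U) (hνU : ν U ≠ ∞)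
    (hUV : ∀ᶠ i in l, ∀ x, s i * x ∈ V → x ∈ U) {p : ι → X → ℝ≥0∞} {q : X → ℝ≥0∞}
    (hp : ∀ i, Measurable (p i)) (hpq : ∀ᵐ x ∂ν, Tendsto (fun i => p i x) l (𝓝 (q x)))
    (hq : ∀ᵐ x ∂ν, q x ≠ ∞) {M : ℝ≥0} (hM : ∀ i, ∀ x ∈ U, p i x ≤ M) {H : X →ᵇ ℝ≥0}
    (hH : ∀ x ∉ V, H x = 0) :
    Tendsto (fun i => ∫⁻ x, p i x * H (s i * x) ∂ν) l (𝓝 (∫⁻ x, q x * H (f * x) ∂ν)) := by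
  refine tendsto_lintegral_filter_of_dominated_convergence
    (U.indicator fun _ => M * (nndist H 0 : ℝ≥0∞))
    (Eventually.of_forall fun i => ?_) ?_ ?_ ?_
  · exact (hp i).mul (H.continuous.comp
      (continuous_const_mul (s i))).measurable.coe_nnreal_ennreal
  · filter_upwards [hUV] with i hi
    refine Eventually.of_forall fun x => ?_
    by_cases hx : x ∈ U
    · rw [indicator_of_mem hx]
      exact mul_le_mul' (hM i x hx)
        (ENNReal.coe_le_coe.2 (by simpa using H.nndist_coe_le_nndist (g := 0) (s i * x)))
    · rw [indicator_of_notMem hx, hH _ (mt (hi x) hx), ENNReal.coe_zero, mul_zero]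
  · rw [lintegral_indicator hU, setLIntegral_const]
    finiteness
  · filter_upwards [hpq, hq] with x hx hqx
    exact ENNReal.Tendsto.mul hx (Or.inr ENNReal.coe_ne_top) (ENNReal.tendsto_coe.2
      ((H.continuous.tendsto _).comp (hs.mul_const x))) (Or.inr hqx)

end TopologicalGroup

theorem exists_mem_Ioo_of_ae_circ {P : Circ → Prop} (hP : ∀ᵐ θ, P θ) {ε : ℝ} (hε : 0 < ε) :
    ∃ x ∈ Ioo 0 ε, P (x : Circ) := by
  obtain ⟨_, ⟨x, hx, rfl⟩, hPx⟩ := (Measure.dense_of_ae hP).inter_open_nonempty _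
    (QuotientAddGroup.isOpenMap_coe _ isOpen_Ioo) ((nonempty_Ioo.2 hε).image _)
  exact ⟨x, hx, hPx⟩

/-! ### The change of variables formula for pinned measures -/

/-- A sequence in `Diff³(𝕋)` along which the change of variables formula of orbital measures
passes to the limit `f ∈ Diff¹(𝕋)`, which is given by `g ∈ Diff³[0,1]`. The factor `f'(0)` in the
limit of the densities is the Jacobian of the action on rotations. -/
structure IsOrbitalApproximation (σ a : ℝ) (g : ℝ → ℝ) (f : CircleDiff 1) (ψ : ℕ → CircleDiff 3) :
    Prop where
  tendsto : Tendsto (fun n => (ψ n : CircleDiff 1)) atTop (𝓝 f)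
  tendsto_orbitalDensity : ∀ {θ : ℕ → ℝ}, Tendsto θ atTop (𝓝 0) → ∀ {t₀ : Circ} {φ : CircleDiff 1},
    φ t₀ = 0 → Tendsto (fun n => orbitalDensity σ a (ψ n) (rot (θ n : Circ) * φ)) atTop
      (𝓝 (f.deriv 0 * pinnedDensity σ a t₀ g φ))
  exists_orbitalDensity_le : ∀ R : ℝ, ∃ M : ℝ, ∀ n (θ : ℝ) (φ : CircleDiff 1),
    (∀ t, φ.deriv t ≤ R) → orbitalDensity σ a (ψ n) (rot (θ : Circ) * φ) ≤ M

theorem CircleDiff.exists_isCircleLift_eqOn {f : CircleDiff 1} {g : ℝ → ℝ}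
    (hg : ContinuousOn g (Icc 0 1)) (hfg : ∀ x ∈ Icc (0 : ℝ) 1, f (x : Circ) = (g x : Circ)) :
    ∃ F, IsCircleLift 1 F ∧ (∀ x : ℝ, f (x : Circ) = (F x : Circ)) ∧ EqOn F g (Icc 0 1) := by
  obtain ⟨n, hn⟩ := exists_int_eqOn_of_coe_eq isPreconnected_Icc
    f.isCircleLift_lift.continuous.continuousOn hg fun x hx => by rw [← f.coe_lift, hfg x hx]
  refine ⟨fun x => f.lift x + -n, f.isCircleLift_lift.add_const (-n), fun x => ?_, fun x hx => ?_⟩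
  · rw [f.coe_lift]
    exact coe_circ_eq_iff.2 ⟨n, by ring⟩
  · simp only [hn x hx]
    ring

section Approximation

variable {σ a : ℝ} {g : ℝ → ℝ} {f : CircleDiff 1}

theorem exists_isOrbitalApproximation (σ a : ℝ) (hg : IsIntervalDiff 3 g)
    (hfg : ∀ x ∈ Icc (0 : ℝ) 1, f (x : Circ) = (g x : Circ)) :
    ∃ ψ, IsOrbitalApproximation σ a g f ψ := by
  obtain ⟨F, hF, hf, hFg⟩ := CircleDiff.exists_isCircleLift_eqOn hg.contDiffOn.continuousOn hfg
  set δ : ℕ → ℝ := fun n => 1 / (n + 1)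
  have hδ (n : ℕ) : δ n ∈ Ioc 0 1 := ⟨Nat.one_div_pos_of_nat, by
    simpa [δ] using Nat.one_div_le_one_div (α := ℝ) n.zero_le⟩
  have hδ0 : Tendsto δ atTop (𝓝 0) := tendsto_one_div_add_atTop_nhds_zero_nat
  have hδ0' : Tendsto δ atTop (𝓝[>] 0) :=
    tendsto_nhdsWithin_iff.2 ⟨hδ0, Eventually.of_forall fun n => (hδ n).1⟩
  have hlift (n : ℕ) : IsCircleLift 3 (smoothedLift g (δ n)) :=
    isCircleLift_smoothedLift hg (hδ n).1 (hδ n).2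
  have hψ (n : ℕ) := CircleDiff.ofLift_coe _ (hlift n)
  have hjacobian : √(derivWithin g (Icc 0 1) 0 * derivWithin g (Icc 0 1) 1) = f.deriv 0 := by
    rw [← hF.derivWithin_zero_eq_one hFg, Real.sqrt_mul_self (hg.deriv_pos 0 (by simp)).le,
      hF.derivWithin_eq_deriv hFg (by simp), ← CircleDiff.deriv_coe hF.continuous hf,
      AddCircle.coe_zero]
  refine ⟨fun n => CircleDiff.ofLift _ (hlift n), ?_, fun {θ} hθ {t₀ φ} hφ => ?_, fun R => ?_⟩
  · have hF0 : F 0 = 0 := (hFg (by simp)).trans hg.map_zero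
    exact CircleDiff.tendsto_of_tendstoUniformly_deriv
      (fun n => (hlift n).of_le (by norm_num)) hψ hF hf
      (fun n => (liftOfLogDeriv_zero _).trans hF0.symm)
      fun u hu => hδ0'.eventually (tendstoUniformly_deriv_smoothedLift hg hF hFg u hu)
  · obtain ⟨t₀, rfl⟩ := exists_coe_circ t₀
    rw [← hjacobian]
    exact tendsto_orbitalDensity_smoothedLift_rot_mul σ a hg hF hFg hδ0 hδ hψ hθ hφ
  · obtain ⟨C, hC⟩ := exists_abs_regularPotential_le a hg hF hFg
    exact ⟨_, fun n θ φ hR => orbitalDensity_smoothedLift_rot_mul_le σ a hg (hδ n).1 (hδ n).2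
      (hC _ (hδ n)) (hψ n) hR θ⟩

namespace IsOrbitalApproximation

variable {ψ : ℕ → CircleDiff 3}

theorem aemeasurable_pinnedDensity (h : IsOrbitalApproximation σ a g f ψ)
    (μ : Measure (CircleDiff 1)) (t₀ : Circ) :
    AEMeasurable (pinnedDensity σ a t₀ g) (pinnedMeasure μ t₀) := by
  refine aemeasurable_of_tendsto_metrizable_ae' (f := fun n φ =>
    (f.deriv 0)⁻¹ * orbitalDensity σ a (ψ n) (rot ((0 : ℝ) : Circ) * φ)) (fun n => ?_) ?_
  · exact ((continuous_orbitalDensity σ a _).comp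
      (continuous_const_mul _)).measurable.aemeasurable.const_mul _
  · filter_upwards [ae_pinnedMeasure_apply_eq_zero μ t₀] with φ hφ
    simpa [(f.deriv_pos 0).ne'] using
      (h.tendsto_orbitalDensity (tendsto_const_nhds (x := (0 : ℝ))) hφ).const_mul (f.deriv 0)⁻¹

theorem tendsto_rot_mul_mul_rot (h : IsOrbitalApproximation σ a g f ψ) (hf0 : f 0 = 0)
    {θ : ℕ → ℝ} (hθ : Tendsto θ atTop (𝓝 0)) :
    Tendsto (fun n => rot (-(ψ n : CircleDiff 1) (θ n : Circ)) * (ψ n : CircleDiff 1)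
      * rot (θ n : Circ)) atTop (𝓝 f) := by
  have hθ' : Tendsto (fun n => (θ n : Circ)) atTop (𝓝 0) :=
    ((AddCircle.continuous_mk' (1 : ℝ)).tendsto 0).comp hθ
  have heval : Tendsto (fun n => -(ψ n : CircleDiff 1) (θ n : Circ)) atTop (𝓝 (-f 0)) :=
    ((CircleDiff.continuous_eval.tendsto (f, 0)).comp (h.tendsto.prodMk_nhds hθ')).neg
  have hrot {η : ℕ → Circ} (hη : Tendsto η atTop (𝓝 0)) :
      Tendsto (fun n => rot (η n)) atTop (𝓝 1) :=
    rot_zero ▸ (CircleDiff.continuous_rot.tendsto 0).comp hη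
  rw [hf0, neg_zero] at heval
  simpa using ((hrot heval).mul h.tendsto).mul (hrot hθ')

end IsOrbitalApproximation

theorem exists_isOpen_deriv_le (ν : Measure (CircleDiff 1)) [IsLocallyFiniteMeasure ν]
    (φ : CircleDiff 1) :
    ∃ U, IsOpen U ∧ φ ∈ U ∧ ν U ≠ ∞ ∧ ∃ R, ∀ χ ∈ U, ∀ t, χ.deriv t ≤ R := by
  obtain ⟨U, hφU, hU, hνU⟩ := ν.exists_isOpen_measure_lt_top φ
  refine ⟨U ∩ {χ | ‖(CircleDiff.toC1 χ).2‖ < ‖(CircleDiff.toC1 φ).2‖ + 1},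
    hU.inter (isOpen_lt ?_ continuous_const), ⟨hφU, lt_add_one ‖(CircleDiff.toC1 φ).2‖⟩,
    ((measure_mono inter_subset_left).trans_lt hνU).ne, _, fun χ hχ t =>
      ((le_abs_self _).trans ((CircleDiff.toC1 χ).2.norm_coe_le_norm t)).trans hχ.2.le⟩
  exact continuous_norm.comp (continuous_snd.comp CircleDiff.isInducing_toC1.continuous)

theorem IsOrbitalMeasure.exists_isOpen_lintegral_pinned_eq {μ : Measure (CircleDiff 1)}
    (hμ : IsOrbitalMeasure σ a μ) {ψ : ℕ → CircleDiff 3} (h : IsOrbitalApproximation σ a g f ψ)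
    (hf0 : f 0 = 0) (t₀ : Circ) (φ₁ : CircleDiff 1) :
    ∃ V, IsOpen V ∧ φ₁ ∈ V ∧ pinnedMeasure μ t₀ V ≠ ∞ ∧
      ∀ H : CircleDiff 1 →ᵇ ℝ≥0, (∀ φ ∉ V, H φ = 0) → ∫⁻ φ, H φ ∂pinnedMeasure μ t₀
        = ∫⁻ φ, ENNReal.ofReal (pinnedDensity σ a t₀ g φ) * H (f * φ) ∂pinnedMeasure μ t₀ := by
  have hν := hμ.isLocallyFiniteMeasure_pinned t₀
  obtain ⟨U, hU, hφU, hνU, R, hR⟩ := exists_isOpen_deriv_le (pinnedMeasure μ t₀) (f⁻¹ * φ₁)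
  obtain ⟨W, hW, V, hV, hφV, hWV⟩ := exists_nhds_forall_mul_mem_imp_mem (hU.mem_nhds hφU)
  obtain ⟨V₀, hφV₀, hV₀, hνV₀⟩ := (pinnedMeasure μ t₀).exists_isOpen_measure_lt_top φ₁
  obtain ⟨M, hM⟩ := h.exists_orbitalDensity_le R
  refine ⟨V ∩ V₀, hV.inter hV₀, ⟨hφV, hφV₀⟩, ((measure_mono inter_subset_right).trans_lt hνV₀).ne,
    fun H hH => ?_⟩
  have hHm : Measurable fun φ => (H φ : ℝ≥0∞) := H.continuous.measurable.coe_nnreal_ennreal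
  have hε (n : ℕ) : (0 : ℝ) < 1 / (n + 1) := Nat.one_div_pos_of_nat
  choose θ hθ hformula using fun n =>
    exists_mem_Ioo_of_ae_circ (hμ.ae_deriv_mul_lintegral_pinned_eq t₀ (ψ n) hHm) (hε n)
  have hθ0 : Tendsto θ atTop (𝓝 0) := squeeze_zero (fun n => (hθ n).1.le) (fun n => (hθ n).2.le)
    tendsto_one_div_add_atTop_nhds_zero_nat
  have hconj := h.tendsto_rot_mul_mul_rot hf0 hθ0
  have hjacobian : Tendsto (fun n => (ψ n : CircleDiff 1).deriv (θ n : Circ)) atTop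
      (𝓝 (f.deriv 0)) :=
    (CircleDiff.continuous_eval_deriv.tendsto (f, 0)).comp
      (h.tendsto.prodMk_nhds (((AddCircle.continuous_mk' (1 : ℝ)).tendsto 0).comp hθ0))
  have hpos : 0 < f.deriv 0 := f.deriv_pos 0
  have hleft := ENNReal.Tendsto.mul_const (b := ∫⁻ φ, H φ ∂pinnedMeasure μ t₀)
    (ENNReal.tendsto_ofReal hjacobian) (Or.inl (ENNReal.ofReal_pos.2 hpos).ne')
  have hright := tendsto_lintegral_mul_comp_mul hconj hU.measurableSet hνU
    ((hconj.eventually_mem hW).mono fun n hn φ hφ => hWV _ hn φ hφ.1)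
    (fun n => (measurable_ofReal_orbitalDensity σ a (ψ n)).comp (continuous_const_mul _).measurable)
    ((ae_pinnedMeasure_apply_eq_zero μ t₀).mono fun φ hφ =>
      ENNReal.tendsto_ofReal (h.tendsto_orbitalDensity hθ0 hφ))
    (Eventually.of_forall fun φ => ENNReal.ofReal_ne_top)
    (fun n φ hφ => ENNReal.ofReal_le_ofReal (hM n (θ n) φ (hR φ hφ))) hH
  have hlimit := tendsto_nhds_unique hleft (hright.congr fun n => (hformula n).symm)
  simp only [ENNReal.ofReal_mul hpos.le, mul_assoc,
    lintegral_const_mul' _ _ ENNReal.ofReal_ne_top] at hlimit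
  exact (ENNReal.mul_right_inj (ENNReal.ofReal_pos.2 hpos).ne' ENNReal.ofReal_ne_top).1 hlimit

theorem IsOrbitalMeasure.pullbackMeasure_pinnedMeasure {μ : Measure (CircleDiff 1)}
    (hμ : IsOrbitalMeasure σ a μ) {ψ : ℕ → CircleDiff 3} (h : IsOrbitalApproximation σ a g f ψ)
    (hf0 : f 0 = 0) (t₀ : Circ) :
    pullbackMeasure f (pinnedMeasure μ t₀)
      = (pinnedMeasure μ t₀).withDensity fun φ => ENNReal.ofReal (pinnedDensity σ a t₀ g φ) := by
  rw [pullbackMeasure_eq_iff, eq_comm]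
  refine measure_ext_of_locally_forall_lintegral_eq fun φ₁ => ?_
  obtain ⟨V, hV, hφV, hνV, hH⟩ := hμ.exists_isOpen_lintegral_pinned_eq h hf0 t₀ φ₁
  refine ⟨V, hV, hφV, hνV, fun H hHV => ?_⟩
  have hmul : Measurable (f * ·) := (continuous_const_mul f).measurable
  have hHm : Measurable fun φ => (H φ : ℝ≥0∞) := H.continuous.measurable.coe_nnreal_ennreal
  rw [lintegral_map hHm hmul, lintegral_withDensity_eq_lintegral_mul₀
    (h.aemeasurable_pinnedDensity μ t₀).ennreal_ofReal
    (g := fun φ => (H (f * φ) : ℝ≥0∞)) (hHm.comp hmul).aemeasurable]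
  exact hH H hHV

end Approximation

theorem pinnedDensity_pos (σ a : ℝ) {g : ℝ → ℝ} (hg : IsIntervalDiff 3 g) (t₀ : Circ)
    (φ : CircleDiff 1) : 0 < pinnedDensity σ a t₀ g φ :=
  mul_pos (one_div_pos.2 (Real.sqrt_pos.2 (mul_pos (hg.deriv_pos 0 (by simp))
    (hg.deriv_pos 1 (by simp))))) (Real.exp_pos _)

/-- `f ∈ Diff¹(𝕋) ∩ Diff³[0,1]` is a diffeomorphism `f` of the circle given on `[0,1]` by
`g ∈ Diff³[0,1]`. -/
theorem mainTheorem6 (σ : ℝ) (hσ : 0 < σ) (a : ℝ) (μ : Measure (CircleDiff 1))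
    (hμ : IsOrbitalMeasure σ a μ) (t₀ : Circ) (f : CircleDiff 1) (g : ℝ → ℝ)
    (hg : IsIntervalDiff 3 g) (hfg : ∀ x ∈ Icc (0 : ℝ) 1, f (x : Circ) = (g x : Circ)) :
    pullbackMeasure f (pinnedMeasure μ t₀) ≪ pinnedMeasure μ t₀ ∧
    pinnedMeasure μ t₀ ≪ pullbackMeasure f (pinnedMeasure μ t₀) ∧
    (pullbackMeasure f (pinnedMeasure μ t₀)).rnDeriv (pinnedMeasure μ t₀)
      =ᵐ[pinnedMeasure μ t₀] (fun φ => ENNReal.ofReal (pinnedDensity σ a t₀ g φ)) ∧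
    pullbackMeasure f (pinnedMeasure μ t₀)
      = (pinnedMeasure μ t₀).withDensity (fun φ => ENNReal.ofReal (pinnedDensity σ a t₀ g φ)) := by
  obtain ⟨ψ, hψ⟩ := exists_isOrbitalApproximation σ a hg hfg
  have hf0 : f 0 = 0 := by simpa [hg.map_zero] using hfg 0 (by simp)
  have hmeas := (hψ.aemeasurable_pinnedDensity μ t₀).ennreal_ofReal
  have hpos : ∀ᵐ φ ∂pinnedMeasure μ t₀, ENNReal.ofReal (pinnedDensity σ a t₀ g φ) ≠ 0 :=
    Eventually.of_forall fun φ => (ENNReal.ofReal_pos.2 (pinnedDensity_pos σ a hg t₀ φ)).ne'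
  have := hμ.isLocallyFiniteMeasure_pinned t₀
  rw [hμ.pullbackMeasure_pinnedMeasure hψ hf0 t₀]
  exact ⟨withDensity_absolutelyContinuous _ _, withDensity_absolutelyContinuous' hmeas hpos,
    Measure.rnDeriv_withDensity₀ _ hmeas, rfl⟩
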